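/- **Theorem 8.10.** Let $n\ge 2$, $m\ge 2$, and let $D\subset\mathbb{R}^{n+1}$ be a bounded Lipschitz domain (a bounded nonempty connected open set which, near each boundary point and in suitable orthonormal coordinates, is the region above the graph of a Lipschitz function $\mathbb{R}^n\to\mathbb{R}$), with surface measure $\sigma$ on $\partial D$ and outward unit normal $n_P$, defined for $\sigma$-a.e. $P\in\partial D$. Let $\omega_n=2\pi^{\frac{n+1}{2}}/\Gamma(\frac{n+1}{2})$ be the area of the unit sphere of $\mathbb{R}^{n+1}$, $\alpha_s=s(s+n+1)$, $\beta_k=\alpha_{2k-n-1}$, $\delta_s=s(s+n-1)$, $\gamma_k=\delta_{2k-n+1}$; empty products are $1$ and empty sums are $0$. For $j\ge 1$ and $x\ne v$ in $\mathbb{R}^{n+1}$ define the vector-valued kernel $$D_j(x,v)=\frac{-1}{\omega_n\,\beta_1\cdots\beta_{j-1}}\,|x-v|^{2j-(n+3)}\,(x-v)$$ if $n$ is even, or if $n$ is odd and $j\le\frac{n+1}{2}$, and $$D_j(x,v)=\frac{-1}{\omega_n\,(n+1)\,\beta_1\cdots\beta_{\frac{n+1}{2}-1}\,\alpha_2\alpha_4\cdots\alpha_{2j-n-3}}\,|x-v|^{2j-(n+3)}\Big[\log|x-v|-\sum_{t=1}^{j-\frac{n+3}{2}}\Big(\frac1{2t}+\frac1{2t+n+1}\Big)\Big](x-v)$$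 if $n$ is odd and $j\ge\frac{n+3}{2}$; and define the scalar kernel $$\mathcal{D}_j(x,v)=\frac{1}{(n-1)\,\omega_n\,\gamma_1\cdots\gamma_{j-1}}\,|x-v|^{2j-(n+1)}$$ if $n$ is even, or if $n$ is odd and $j\le\frac{n-1}{2}$, and $$\mathcal{D}_j(x,v)=\frac{1}{(n-1)^2\,\omega_n\,\gamma_1\cdots\gamma_{\frac{n-1}{2}-1}\,\delta_2\delta_4\cdots\delta_{2j-n-1}}\,|x-v|^{2j-(n+1)}\Big[\log|x-v|+\frac1{n+1}-\sum_{t=1}^{j-\frac{n+1}{2}}\Big(\frac1{2t}+\frac1{2t+n-1}\Big)\Big]$$ if $n$ is odd and $j\ge\frac{n+1}{2}$. For a real-valued function $f$ on $\partial D$ put $$\mathbf{K}^*_m f(P)=\int_{\partial D}\langle D_m(Q,P),n_P\rangle f(Q)\,d\sigma(Q),\qquad \mathcal{N}_{m-1}(Y)=\int_D\mathcal{D}_{m-1}(X,Y)\,dX\quad(Y\in\mathbb{R}^{n+1}).$$ 1. There is a constant $C<\infty$ depending only on $m,n,D$ such that, for all $1\le p\le\infty$ and all $f\in L^p(\partial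 D)$, the integral defining $\mathbf{K}^*_m f(P)$ converges absolutely for $\sigma$-a.e. $P$, $\mathbf{K}^*_m f\in L^p(\partial D)$, and $$\|\mathbf{K}^*_m f\|_{L^p(\partial D)}\le C\,\|f\|_{L^p(\partial D)}.$$ 2. The integral defining $\mathcal{N}_{m-1}(Y)$ converges absolutely for every $Y\in\mathbb{R}^{n+1}$. For all $1\le p\le\infty$ and $f\in L^p(\partial D)$ the functions $\mathcal{N}_{m-1}f$ and $\mathbf{K}^*_m f$ are $\sigma$-integrable on $\partial D$, and if $$\int_{\partial D}\mathcal{N}_{m-1}(Q)f(Q)\,d\sigma(Q)=0,\qquad\text{then}\qquad\int_{\partial D}\mathbf{K}^*_m f(P)\,d\sigma(P)=0.$$ -/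

import Mathlib

open MeasureTheory
open scoped NNReal ENNReal Topology

noncomputable section

/-- A bounded Lipschitz domain in `ℝ^{n+1}`: a bounded, connected, nonempty open set which near
each of its boundary points is, in suitable orthonormal coordinates
`(x, t) ∈ ℝ^n × ℝ` (the rotation `R`), the region `t > φ x` above the graph of a Lipschitz
function `φ : ℝ^n → ℝ`.  (The boundary is compact, so finitely many such neighbourhoods suffice,
and each of them contains a coordinate cylinder around its centre.) -/
structure IsBoundedLipschitzDomain (n : ℕ) (D : Set (EuclideanSpace ℝ (Fin (n + 1)))) : Prop where
  isOpen : IsOpen D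
  isConnected : IsConnected D
  isBounded : Bornology.IsBounded D
  locally_graph : ∀ P ∈ frontier D, ∃ r : ℝ, 0 < r ∧
    ∃ R : EuclideanSpace ℝ (Fin (n + 1)) ≃ₗᵢ[ℝ] EuclideanSpace ℝ (Fin (n + 1)),
    ∃ φ : EuclideanSpace ℝ (Fin n) → ℝ, ∃ L : ℝ≥0, LipschitzWith L φ ∧
      ∀ X ∈ Metric.ball P r,
        (X ∈ D ↔ φ (WithLp.toLp 2 fun i : Fin n => R X i.castSucc) < R X (Fin.last n))

/-- The surface measure `σ` on `∂D`: `n`-dimensional Hausdorff measure (normalized to agree with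
Lebesgue measure on `ℝ^n`) restricted to the boundary of `D ⊆ ℝ^{n+1}`. -/
def surfaceMeasure (n : ℕ) (D : Set (EuclideanSpace ℝ (Fin (n + 1)))) :
    Measure (EuclideanSpace ℝ (Fin (n + 1))) :=
  (μHE[n] : Measure (EuclideanSpace ℝ (Fin (n + 1)))).restrict (frontier D)

/-- `ν` is an outward unit normal to `D` at `P`: in the limit `X → P`, the set `D` coincides with
the half-space `⟨X - P, ν⟩ < 0` up to arbitrarily thin cones around the hyperplane
`⟨X - P, ν⟩ = 0`.  If `D` is near `P` the region `t > φ x` above a graph with `φ` differentiable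
at the base point of `P`, this holds exactly for `ν = (∇φ, -1) / √(1 + |∇φ|²)`. -/
def IsOuterUnitNormal {n : ℕ} (D : Set (EuclideanSpace ℝ (Fin (n + 1))))
    (P ν : EuclideanSpace ℝ (Fin (n + 1))) : Prop :=
  ‖ν‖ = 1 ∧ ∀ ε : ℝ, 0 < ε → ∀ᶠ X in 𝓝 P,
    (inner ℝ (X - P) ν < -(ε * ‖X - P‖) → X ∈ D) ∧
    (ε * ‖X - P‖ < inner ℝ (X - P) ν → X ∉ D)

/-- An outward unit normal is unique when it exists. -/
theorem IsOuterUnitNormal.unique {n : ℕ} {D : Set (EuclideanSpace ℝ (Fin (n + 1)))}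
    {P ν ν' : EuclideanSpace ℝ (Fin (n + 1))}
    (h : IsOuterUnitNormal D P ν) (h' : IsOuterUnitNormal D P ν') : ν = ν' := by
  by_contra hne
  have hlt : inner ℝ ν ν' < (1 : ℝ) :=
    inner_lt_one_iff_real_of_norm_eq_one h.1 h'.1 |>.2 hne
  have hw : 0 < ‖ν' - ν‖ := norm_pos_iff.2 (sub_ne_zero.2 (Ne.symm hne))
  set c : ℝ := 1 - inner ℝ ν ν' with hc
  have hc0 : 0 < c := by linarith
  have hcc : inner ℝ ν' ν = inner ℝ ν ν' := real_inner_comm _ _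
  have hε : 0 < c / (2 * ‖ν' - ν‖) := by positivity
  have ev := (h.2 _ hε).and (h'.2 _ hε)
  have hcont : Filter.Tendsto (fun t : ℝ => P + t • (ν' - ν)) (𝓝[>] 0) (𝓝 P) := by
    have : Filter.Tendsto (fun t : ℝ => P + t • (ν' - ν)) (𝓝 0) (𝓝 (P + (0 : ℝ) • (ν' - ν))) :=
      Continuous.tendsto (by fun_prop) 0
    rw [zero_smul, add_zero] at this
    exact this.mono_left nhdsWithin_le_nhds
  obtain ⟨t, ⟨ht1, ht2⟩, ht⟩ := ((hcont.eventually ev).and self_mem_nhdsWithin).exists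
  have ht0 : (0 : ℝ) < t := ht
  have e0 : P + t • (ν' - ν) - P = t • (ν' - ν) := by abel
  have e1 : inner ℝ (t • (ν' - ν)) ν = -(t * c) := by
    rw [real_inner_smul_left, inner_sub_left, real_inner_self_eq_norm_sq, h.1, hcc, hc]; ring
  have e2 : inner ℝ (t • (ν' - ν)) ν' = t * c := by
    rw [real_inner_smul_left, inner_sub_left, real_inner_self_eq_norm_sq, h'.1, hc]; ring
  have e3 : c / (2 * ‖ν' - ν‖) * ‖t • (ν' - ν)‖ = t * c / 2 := by
    rw [norm_smul, Real.norm_of_nonneg ht0.le]; field_simp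
  rw [e0, e1, e3] at ht1
  rw [e0, e2, e3] at ht2
  have : 0 < t * c := by positivity
  exact ht2.2 (by linarith) (ht1.1 (by linarith))

open Classical in
/-- The outward unit normal `n_P` at `P`, and `0` at the points where there is none (on the
boundary of a Lipschitz domain these form a set of surface measure zero). -/
def outerNormal {n : ℕ} (D : Set (EuclideanSpace ℝ (Fin (n + 1))))
    (P : EuclideanSpace ℝ (Fin (n + 1))) : EuclideanSpace ℝ (Fin (n + 1)) :=
  if h : ∃ ν, IsOuterUnitNormal D P ν then h.choose else 0

/-- The area `ω_n` of the unit sphere `S^n` in `ℝ^{n+1}`. -/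
def sphereArea (n : ℕ) : ℝ :=
  2 * Real.pi ^ (((n : ℝ) + 1) / 2) / Real.Gamma (((n : ℝ) + 1) / 2)

/-- `α_s = s (s + n + 1)`; it is only used below where it is nonzero. -/
def alphaCoeff (n : ℕ) (s : ℝ) : ℝ := s * (s + n + 1)

/-- `β_k = α_{2k-n-1}`. -/
def betaCoeff (n k : ℕ) : ℝ := alphaCoeff n (2 * (k : ℝ) - n - 1)

/-- `δ_s = s (s + n - 1)`; it is only used below where it is nonzero. -/
def deltaCoeff (n : ℕ) (s : ℝ) : ℝ := s * (s + n - 1)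

/-- `γ_k = δ_{2k-n+1}`. -/
def gammaCoeff (n k : ℕ) : ℝ := deltaCoeff n (2 * (k : ℝ) - n + 1)

/-- The `m`th order Poisson field `D_m = (D_m^{(1)}, …, D_m^{(n+1)})` on `ℝ^{n+1}`, `m ≥ 1`.
The first branch covers even `n`, and odd `n` with `m ≤ (n+1)/2`; the second one covers odd `n`
with `m ≥ (n+3)/2`.  For `m = 1` the product is empty and
`D_1 (x, v) = -(x - v) / (ω_n |x - v|^{n+1})`. -/
def poissonField (n m : ℕ) (x v : EuclideanSpace ℝ (Fin (n + 1))) :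
    EuclideanSpace ℝ (Fin (n + 1)) :=
  if Even n ∨ 2 * m ≤ n + 1 then
    ((-(1 / sphereArea n)) / (∏ k ∈ Finset.Icc 1 (m - 1), betaCoeff n k)
      * ‖x - v‖ ^ (2 * (m : ℤ) - ((n : ℤ) + 3))) • (x - v)
  else
    ((-(1 / sphereArea n)) / (((n : ℝ) + 1)
        * (∏ k ∈ Finset.Icc 1 ((n + 1) / 2 - 1), betaCoeff n k)
        * (∏ t ∈ Finset.Icc 1 (m - (n + 3) / 2), alphaCoeff n (2 * (t : ℝ))))
      * ‖x - v‖ ^ (2 * (m : ℤ) - ((n : ℤ) + 3))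
      * (Real.log ‖x - v‖
        - ∑ t ∈ Finset.Icc 1 (m - (n + 3) / 2),
            (1 / (2 * (t : ℝ)) + 1 / (2 * (t : ℝ) + n + 1)))) • (x - v)

/-- The kernels `𝒟_m` on `ℝ^{n+1}`, `m ≥ 1` (so that `-𝒟_1` is the fundamental solution of the
Laplacian and `Δ 𝒟_m = 𝒟_{m-1}`).  The first branch covers even `n`, and odd `n` with
`m ≤ (n-1)/2`; the second one covers odd `n` with `m ≥ (n+1)/2`.  For `m = 1` the product is empty
and `𝒟_1 (x, v) = 1 / ((n-1) ω_n |x - v|^{n-1})`. -/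
def polyharmonicKernel (n m : ℕ) (x v : EuclideanSpace ℝ (Fin (n + 1))) : ℝ :=
  if Even n ∨ 2 * m + 1 ≤ n then
    (1 / (((n : ℝ) - 1) * sphereArea n)) / (∏ k ∈ Finset.Icc 1 (m - 1), gammaCoeff n k)
      * ‖x - v‖ ^ (2 * (m : ℤ) - ((n : ℤ) + 1))
  else
    (1 / (((n : ℝ) - 1) * sphereArea n)) / (((n : ℝ) - 1)
        * (∏ k ∈ Finset.Icc 1 ((n - 1) / 2 - 1), gammaCoeff n k)
        * (∏ t ∈ Finset.Icc 1 (m - (n + 1) / 2), deltaCoeff n (2 * (t : ℝ))))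
      * ‖x - v‖ ^ (2 * (m : ℤ) - ((n : ℤ) + 1))
      * (Real.log ‖x - v‖ + 1 / ((n : ℝ) + 1)
        - ∑ t ∈ Finset.Icc 1 (m - (n + 1) / 2),
            (1 / (2 * (t : ℝ)) + 1 / (2 * (t : ℝ) + n - 1)))

/-- The integral kernel `⟨D_m(Q, P), n_P⟩` of `K*_m`. -/
def adjointKernel {n : ℕ} (m : ℕ) (D : Set (EuclideanSpace ℝ (Fin (n + 1))))
    (P Q : EuclideanSpace ℝ (Fin (n + 1))) : ℝ :=
  inner ℝ (poissonField n m Q P) (outerNormal D P)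

/-- `K*_m f (P) = ∫_{∂D} ⟨D_m(Q, P), n_P⟩ f(Q) dσ(Q)`. -/
def adjointOperator {n : ℕ} (m : ℕ) (D : Set (EuclideanSpace ℝ (Fin (n + 1))))
    (f : EuclideanSpace ℝ (Fin (n + 1)) → ℝ) (P : EuclideanSpace ℝ (Fin (n + 1))) : ℝ :=
  ∫ Q, adjointKernel m D P Q * f Q ∂(surfaceMeasure n D)

/-- The `l`th order Newtonian potential `𝒩_l(Y) = ∫_D 𝒟_l(X, Y) dX` of `D`. -/
def newtonianPotential {n : ℕ} (l : ℕ) (D : Set (EuclideanSpace ℝ (Fin (n + 1))))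
    (Y : EuclideanSpace ℝ (Fin (n + 1))) : ℝ :=
  ∫ X in D, polyharmonicKernel n l X Y

end

/-! ### Area formula for Lipschitz graphs -/

section AreaFormula

open Module Set

/-! Both kernels come from one radial profile ρ(s) = s^b (l log s + κ) with 2b = 2m - n - 3. Off the
diagonal D_m(x, v) is a multiple e of the field ρ(|x - v|²)(x - v), and 𝒟_{m-1}(x, v) is a nonzero
multiple d of the divergence of that field (`exists_radialProfile_kernels`). The divergence theorem
turns 𝒩_{m-1}(Q) into d ∫ k(P, Q) dσ(P), where k(P, Q) = ρ(|P - Q|²)⟨n_P, P - Q⟩ is `surfaceKernel`,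
and the kernel of K*_m is -e k(P, Q). By Fubini, ∫ K*_m f dσ = -e ∫ f(Q) (∫ k(P, Q) dσ(P)) dσ(Q) =
-(e/d) ∫ 𝒩_{m-1} f dσ, which gives the implication.

The estimates use m ≥ 2 only through b > -n/2: then |ρ(r²)| ≤ A r^{-n} on bounded sets, logarithm
included. So the divergence of the field is integrable in dimension n + 1, and |k(P, Q)| ≤ A |P -
Q|^{-(n-1)} is weakly singular on an n-dimensional boundary. Since σ(B(P, r)) ≤ C rⁿ, the row and
column integrals of k are uniformly bounded (`exists_surfaceKernel_bound`), and the Schur test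
`eLpNorm_kernel_le` bounds K*_m on every L^p with one constant.

The divergence theorem is built up from graphs. The area formula identifies Hausdorff measure on a
Lipschitz graph with √(1 + |∇φ|²) dx. A vertical shear reduces the epigraph to a half-space, charts
carry this to ∂D, and a partition of unity glues the local statements. For the singular fields |X -
Q|² is replaced by |X - Q|² + ε², and ε → 0 by dominated convergence (`setIntegral_radialProfile`).
-/

theorem measure_le_mul_of_countable_cover {α : Type*} [MeasurableSpace α] {M N : Measure α}
    {c : ℝ≥0∞} {T : ℕ → Set α} (hT : ∀ i, MeasurableSet (T i)) {s : Set α} (hs : MeasurableSet s)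
    (hcov : s ⊆ ⋃ i, T i)
    (h : ∀ i t, MeasurableSet t → t ⊆ s → t ⊆ T i → M t ≤ c * N t) : M s ≤ c * N s := by
  have hd : s = ⋃ i, s ∩ disjointed T i := by
    rw [← inter_iUnion, iUnion_disjointed, inter_eq_self_of_subset_left hcov]
  have hm : ∀ i, MeasurableSet (s ∩ disjointed T i) :=
    fun i => hs.inter (MeasurableSet.disjointed hT i)
  have hdis : Pairwise (Function.onFun Disjoint fun i => s ∩ disjointed T i) :=
    fun i j hij => (disjoint_disjointed T hij).mono inter_subset_right inter_subset_right
  rw [hd, measure_iUnion hdis hm, measure_iUnion hdis hm, ← ENNReal.tsum_mul_left]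
  exact ENNReal.tsum_le_tsum fun i =>
    h i _ (hm i) inter_subset_left (inter_subset_right.trans (disjointed_subset T i))

/-- The hypothesis forces f to factor on t through g by a K-Lipschitz map, so neither map need be
injective. Used in both directions between a graph and its linearization. -/
theorem euclideanHausdorffMeasure_image_le_of_dist_le {X Y Z : Type*}
    [MetricSpace Y] [MeasurableSpace Y] [BorelSpace Y]
    [MetricSpace Z] [MeasurableSpace Z] [BorelSpace Z] {f : X → Y} {g : X → Z} {t : Set X}
    {K : ℝ≥0} (d : ℕ) (h : ∀ x ∈ t, ∀ y ∈ t, dist (f x) (f y) ≤ K * dist (g x) (g y)) :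
    (μHE[d] : Measure Y) (f '' t) ≤ (K : ℝ≥0∞) ^ d * (μHE[d] : Measure Z) (g '' t) := by
  rcases t.eq_empty_or_nonempty with rfl | ⟨x₀, hx₀⟩
  · simp
  have : Nonempty X := ⟨x₀⟩
  set w : Z → Y := fun z => f (Function.invFunOn g t z) with hw
  have hinv : ∀ x ∈ t, Function.invFunOn g t (g x) ∈ t ∧ g (Function.invFunOn g t (g x)) = g x :=
    fun x hx => ⟨Function.invFunOn_mem ⟨x, hx, rfl⟩, Function.invFunOn_eq ⟨x, hx, rfl⟩⟩
  have himg : f '' t = w '' (g '' t) := by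
    rw [image_image]
    refine image_congr fun x hx => ?_
    have := h x hx _ (hinv x hx).1
    rw [(hinv x hx).2, dist_self, mul_zero] at this
    exact dist_le_zero.1 this
  have hL : LipschitzOnWith K w (g '' t) := by
    refine LipschitzOnWith.of_dist_le_mul ?_
    rintro _ ⟨x, hx, rfl⟩ _ ⟨y, hy, rfl⟩
    have := h _ (hinv x hx).1 _ (hinv y hy).1
    rwa [(hinv x hx).2, (hinv y hy).2] at this
  rw [himg, Measure.euclideanHausdorffMeasure_def, Measure.euclideanHausdorffMeasure_def,
    Measure.smul_apply, Measure.smul_apply]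
  have := hL.hausdorffMeasure_image_le (d := (d : ℝ)) (by positivity)
  rw [ENNReal.rpow_natCast] at this
  rw [ENNReal.smul_def, ENNReal.smul_def, smul_eq_mul, smul_eq_mul, mul_left_comm]
  gcongr

theorem isClosedEmbedding_prodMk_graph {E : Type*} [TopologicalSpace E] {φ : E → ℝ}
    (hφ : Continuous φ) : Topology.IsClosedEmbedding (fun x => (x, φ x)) := by
  refine Topology.IsClosedEmbedding.of_continuous_injective_isClosedMap (by fun_prop)
    (fun x y h => (Prod.ext_iff.1 h).1) fun s hs => ?_
  have : (fun x => (x, φ x)) '' s = {p : E × ℝ | p.1 ∈ s ∧ p.2 = φ p.1} := by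
    ext ⟨x, t⟩
    simp only [mem_image, Prod.mk.injEq, mem_ofPred_eq]
    constructor
    · rintro ⟨y, hy, rfl, rfl⟩; exact ⟨hy, rfl⟩
    · rintro ⟨hx, rfl⟩; exact ⟨x, hx, rfl, rfl⟩
  rw [this]
  exact (hs.preimage continuous_fst).inter (isClosed_eq continuous_snd (by fun_prop))

variable {E V : Type*} [NormedAddCommGroup E] [InnerProductSpace ℝ E] [FiniteDimensional ℝ E]
  [NormedAddCommGroup V] [InnerProductSpace ℝ V]

/-- The Jacobian of the graph of a function with derivative `A`. -/
noncomputable def graphJacobian (A : E →L[ℝ] ℝ) : ℝ := √(1 + ‖A‖ ^ 2)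

omit [FiniteDimensional ℝ E] in
theorem one_le_graphJacobian (A : E →L[ℝ] ℝ) : 1 ≤ graphJacobian A := by
  rw [graphJacobian, Real.one_le_sqrt]; nlinarith [sq_nonneg ‖A‖]

omit [FiniteDimensional ℝ E] in
theorem graphJacobian_pos (A : E →L[ℝ] ℝ) : 0 < graphJacobian A :=
  zero_lt_one.trans_le (one_le_graphJacobian A)

omit [FiniteDimensional ℝ E] in
theorem continuous_graphJacobian : Continuous (graphJacobian (E := E)) := by
  unfold graphJacobian; fun_prop

omit [FiniteDimensional ℝ E] in
-- Since A ↦ √(1 + ‖A‖²) is 1-Lipschitz and at least 1, an additive error δ in the derivative costs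
-- a factor 1 + δ, which multiplies well with the bi-Lipschitz factors.
theorem graphJacobian_le_mul {A B : E →L[ℝ] ℝ} {δ : ℝ} (h : ‖A - B‖ ≤ δ) :
    graphJacobian A ≤ (1 + δ) * graphJacobian B := by
  have hδ : 0 ≤ δ := (norm_nonneg _).trans h
  have hA : ‖A‖ ≤ ‖B‖ + δ := by
    have := norm_add_le B (A - B)
    rw [add_sub_cancel] at this
    linarith
  have hB := one_le_graphJacobian B
  have hBs : graphJacobian B ^ 2 = 1 + ‖B‖ ^ 2 := Real.sq_sqrt (by positivity)
  have hBn : ‖B‖ ≤ graphJacobian B := Real.le_sqrt_of_sq_le (by linarith)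
  refine Real.sqrt_le_iff.2 ⟨by positivity, ?_⟩
  nlinarith [norm_nonneg A, norm_nonneg B, mul_nonneg hδ (norm_nonneg B),
    mul_nonneg hδ (sub_nonneg.2 hBn), mul_nonneg (mul_nonneg hδ hδ) (sub_nonneg.2 hB)]

/-- The linear map parametrizing the graph of `A` in the coordinates `ι`. -/
noncomputable def linearGraph (ι : (E × ℝ) ≃L[ℝ] V) (A : E →L[ℝ] ℝ) : E →L[ℝ] V :=
  (ι : E × ℝ →L[ℝ] V).comp ((ContinuousLinearMap.id ℝ E).prod A)

omit [FiniteDimensional ℝ E] in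
theorem linearGraph_apply (ι : (E × ℝ) ≃L[ℝ] V) (A : E →L[ℝ] ℝ) (x : E) :
    linearGraph ι A x = ι (x, A x) := rfl

/-- The Gram matrix of the images of an orthonormal basis is 1 + a aᵀ, with a the coordinates of A,
and the matrix determinant lemma applies. The hypothesis `hι` replaces an isometry assumption
because E × ℝ carries the sup norm. -/
theorem normDet_linearGraph {ι : (E × ℝ) ≃L[ℝ] V}
    (hι : ∀ p q, inner ℝ (ι p) (ι q) = inner ℝ p.1 q.1 + p.2 * q.2) (A : E →L[ℝ] ℝ) :
    (linearGraph ι A : E →ₗ[ℝ] V).normDet = graphJacobian A := by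
  set b := stdOrthonormalBasis ℝ E
  have h := LinearMap.normDet_sq_eq_det_gram (linearGraph ι A : E →ₗ[ℝ] V) b
  have hg : Matrix.gram ℝ (fun i => (linearGraph ι A : E →ₗ[ℝ] V) (b i))
      = 1 + Matrix.replicateCol Unit (fun i => A (b i)) *
        Matrix.replicateRow Unit (fun i => A (b i)) := by
    ext i j
    rw [Matrix.gram_apply]
    change inner ℝ (ι (b i, A (b i))) (ι (b j, A (b j))) = _
    rw [hι]
    simp [Matrix.mul_apply, orthonormal_iff_ite.1 b.orthonormal i j, Matrix.one_apply]
  rw [hg, Matrix.det_one_add_replicateCol_mul_replicateRow] at h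
  have hA : ‖A‖ ^ 2 = ∑ i, A (b i) * A (b i) := by
    set a := (InnerProductSpace.toDual ℝ E).symm A
    have ha : ∀ x, A x = inner ℝ a x := fun x => by
      simp [a]
    have hn : ‖A‖ = ‖a‖ := by simp [a]
    rw [hn, ← b.sum_sq_norm_inner_left a]
    refine Finset.sum_congr rfl fun i _ => ?_
    rw [ha, Real.norm_eq_abs, sq_abs, sq]
  have h2 : (linearGraph ι A : E →ₗ[ℝ] V).normDet ^ 2 = 1 + ‖A‖ ^ 2 := by
    rw [hA]; simpa [dotProduct] using h
  rw [graphJacobian, ← h2, Real.sqrt_sq (LinearMap.normDet_nonneg _)]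

omit [FiniteDimensional ℝ E] in
theorem norm_sq_graphCoord {ι : (E × ℝ) ≃L[ℝ] V}
    (hι : ∀ p q, inner ℝ (ι p) (ι q) = inner ℝ p.1 q.1 + p.2 * q.2) (p : E × ℝ) :
    ‖ι p‖ ^ 2 = ‖p.1‖ ^ 2 + p.2 ^ 2 := by
  rw [← real_inner_self_eq_norm_sq, hι, real_inner_self_eq_norm_sq, sq p.2]

omit [FiniteDimensional ℝ E] in
theorem norm_fst_le_graphCoord {ι : (E × ℝ) ≃L[ℝ] V}
    (hι : ∀ p q, inner ℝ (ι p) (ι q) = inner ℝ p.1 q.1 + p.2 * q.2) (p : E × ℝ) :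
    ‖p.1‖ ≤ ‖ι p‖ := by
  have := norm_sq_graphCoord hι p
  exact abs_le_of_sq_le_sq' (by nlinarith [sq_nonneg p.2]) (norm_nonneg _) |>.2

omit [FiniteDimensional ℝ E] in
theorem norm_graphCoord_zero_left {ι : (E × ℝ) ≃L[ℝ] V}
    (hι : ∀ p q, inner ℝ (ι p) (ι q) = inner ℝ p.1 q.1 + p.2 * q.2) (t : ℝ) :
    ‖ι (0, t)‖ = |t| := by
  have := norm_sq_graphCoord hι (0, t)
  simp only [norm_zero, ne_eq, OfNat.ofNat_ne_zero, not_false_eq_true, zero_pow, zero_add] at this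
  rw [← abs_norm]
  exact (sq_eq_sq_iff_abs_eq_abs _ _).1 this

/-- The parametrization of the graph of `φ` in the coordinates `ι`. -/
def graphMap (ι : (E × ℝ) ≃L[ℝ] V) (φ : E → ℝ) (x : E) : V := ι (x, φ x)

omit [FiniteDimensional ℝ E] in
theorem dist_le_dist_graphMap {ι : (E × ℝ) ≃L[ℝ] V}
    (hι : ∀ p q, inner ℝ (ι p) (ι q) = inner ℝ p.1 q.1 + p.2 * q.2) (φ : E → ℝ) (x y : E) :
    dist x y ≤ dist (graphMap ι φ x) (graphMap ι φ y) := by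
  rw [dist_eq_norm, dist_eq_norm, graphMap, graphMap, ← map_sub]
  exact norm_fst_le_graphCoord hι ((x, φ x) - (y, φ y))

omit [FiniteDimensional ℝ E] in
theorem dist_graphMap_le {ι : (E × ℝ) ≃L[ℝ] V}
    (hι : ∀ p q, inner ℝ (ι p) (ι q) = inner ℝ p.1 q.1 + p.2 * q.2) {φ : E → ℝ} {L : ℝ≥0}
    (hφ : LipschitzWith L φ) (x y : E) :
    dist (graphMap ι φ x) (graphMap ι φ y) ≤ (1 + L : ℝ≥0) * dist x y := by
  rw [dist_eq_norm, dist_eq_norm, graphMap, graphMap, ← map_sub]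
  have h1 := norm_sq_graphCoord hι ((x, φ x) - (y, φ y))
  have h2 := hφ.dist_le_mul x y
  rw [dist_eq_norm, dist_eq_norm, Real.norm_eq_abs] at h2
  have h3 : (φ x - φ y) ^ 2 ≤ (L * ‖x - y‖) ^ 2 := by
    rw [← sq_abs]; gcongr
  refine abs_le_of_sq_le_sq' ?_ (by positivity) |>.2
  rw [h1]
  simp only [Prod.fst_sub, Prod.snd_sub, NNReal.coe_add, NNReal.coe_one]
  nlinarith [mul_nonneg L.2 (sq_nonneg ‖x - y‖), NNReal.coe_nonneg L]

omit [FiniteDimensional ℝ E] in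
-- The two increments differ by a vertical vector of length at most δ‖x - y‖, and ‖x - y‖ is at most
-- either increment because projection to E does not increase length.
theorem dist_graphMap_linearGraph {ι : (E × ℝ) ≃L[ℝ] V}
    (hι : ∀ p q, inner ℝ (ι p) (ι q) = inner ℝ p.1 q.1 + p.2 * q.2) {φ : E → ℝ}
    {A : E →L[ℝ] ℝ} {t : Set E} {δ : ℝ≥0} (h : ApproximatesLinearOn φ A t δ) {x y : E}
    (hx : x ∈ t) (hy : y ∈ t) :
    dist (graphMap ι φ x) (graphMap ι φ y)
        ≤ (1 + δ : ℝ≥0) * dist (linearGraph ι A x) (linearGraph ι A y) ∧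
      dist (linearGraph ι A x) (linearGraph ι A y)
        ≤ (1 + δ : ℝ≥0) * dist (graphMap ι φ x) (graphMap ι φ y) := by
  have e := h x hx y hy
  have key : ‖(graphMap ι φ x - graphMap ι φ y) - (linearGraph ι A x - linearGraph ι A y)‖
      ≤ δ * ‖x - y‖ := by
    have : (graphMap ι φ x - graphMap ι φ y) - (linearGraph ι A x - linearGraph ι A y)
        = ι (0, φ x - φ y - A (x - y)) := by
      simp only [graphMap, linearGraph_apply, ← map_sub]
      congr 1
      ext <;> simp
    rw [this, norm_graphCoord_zero_left hι]
    exact e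
  have g1 := dist_le_dist_graphMap hι φ x y
  have g2 := dist_le_dist_graphMap hι A x y
  change dist x y ≤ dist (linearGraph ι A x) (linearGraph ι A y) at g2
  rw [dist_eq_norm, dist_eq_norm] at g1 g2
  rw [dist_eq_norm, dist_eq_norm]
  have t1 := norm_sub_norm_le (graphMap ι φ x - graphMap ι φ y)
    (linearGraph ι A x - linearGraph ι A y)
  have t2 := norm_sub_norm_le (linearGraph ι A x - linearGraph ι A y)
    (graphMap ι φ x - graphMap ι φ y)
  rw [norm_sub_rev (linearGraph ι A x - linearGraph ι A y)] at t2
  have m1 := mul_le_mul_of_nonneg_left g1 δ.2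
  have m2 := mul_le_mul_of_nonneg_left g2 δ.2
  push_cast
  change (δ : ℝ) * _ ≤ δ * _ at m1
  change (δ : ℝ) * _ ≤ δ * _ at m2
  constructor <;> nlinarith

variable [MeasurableSpace E] [BorelSpace E] [MeasurableSpace V] [BorelSpace V]

omit [FiniteDimensional ℝ E] in
theorem measurableEmbedding_graphMap (ι : (E × ℝ) ≃L[ℝ] V) {φ : E → ℝ} (hφ : Continuous φ) :
    MeasurableEmbedding (graphMap ι φ) := by
  exact (ι.toHomeomorph.isClosedEmbedding.comp
    (isClosedEmbedding_prodMk_graph hφ)).measurableEmbedding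

omit [FiniteDimensional ℝ E] in
theorem measurable_graphJacobian_fderiv (φ : E → ℝ) :
    Measurable fun x => graphJacobian (fderiv ℝ φ x) :=
  continuous_graphJacobian.measurable.comp (measurable_fderiv ℝ φ)

/-- Of the d + 1 factors 1 + δ, d come from comparing Hausdorff measures of the graph and its
linearization, and one from replacing the Jacobian of A by that of the derivative of φ. -/
theorem graph_area_piece {ι : (E × ℝ) ≃L[ℝ] V}
    (hι : ∀ p q, inner ℝ (ι p) (ι q) = inner ℝ p.1 q.1 + p.2 * q.2) {φ : E → ℝ}
    {A : E →L[ℝ] ℝ} {t : Set E} {δ : ℝ≥0}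
    (h : ApproximatesLinearOn φ A t δ)
    (hA : ∀ x ∈ t, ‖A - fderiv ℝ φ x‖ ≤ δ) :
    (μHE[finrank ℝ E] : Measure V) (graphMap ι φ '' t)
        ≤ ((1 + δ : ℝ≥0) : ℝ≥0∞) ^ (finrank ℝ E + 1) *
          ∫⁻ x in t, ENNReal.ofReal (graphJacobian (fderiv ℝ φ x)) ∧
    ∫⁻ x in t, ENNReal.ofReal (graphJacobian (fderiv ℝ φ x))
      ≤ ((1 + δ : ℝ≥0) : ℝ≥0∞) ^ (finrank ℝ E + 1) *
        (μHE[finrank ℝ E] : Measure V) (graphMap ι φ '' t) := by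
  have hlin : (μHE[finrank ℝ E] : Measure V) (linearGraph ι A '' t)
      = ENNReal.ofReal (graphJacobian A) * volume t := by
    rw [← normDet_linearGraph hι A]
    exact LinearMap.euclideanHausdorffMeasure_image_eq_normDet_mul_volume
      (linearGraph ι A : E →ₗ[ℝ] V) t
  have h1 := euclideanHausdorffMeasure_image_le_of_dist_le (finrank ℝ E)
    fun x hx y hy => (dist_graphMap_linearGraph hι h hx hy).1
  have h2 := euclideanHausdorffMeasure_image_le_of_dist_le (finrank ℝ E)
    fun x hx y hy => (dist_graphMap_linearGraph hι h hx hy).2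
  have hδ : ((1 + δ : ℝ≥0) : ℝ≥0∞) = ENNReal.ofReal (1 + δ) := by
    rw [← ENNReal.ofReal_coe_nnreal]; simp
  have i1 : ENNReal.ofReal (graphJacobian A) * volume t
      ≤ ((1 + δ : ℝ≥0) : ℝ≥0∞) * ∫⁻ x in t, ENNReal.ofReal (graphJacobian (fderiv ℝ φ x)) := by
    rw [← setLIntegral_const, ← lintegral_const_mul _
      (measurable_graphJacobian_fderiv φ).ennreal_ofReal]
    refine setLIntegral_mono ((measurable_graphJacobian_fderiv φ).ennreal_ofReal.const_mul _) ?_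
    intro x hx
    rw [hδ, ← ENNReal.ofReal_mul (by positivity)]
    exact ENNReal.ofReal_le_ofReal (graphJacobian_le_mul (hA x hx))
  have i2 : ∫⁻ x in t, ENNReal.ofReal (graphJacobian (fderiv ℝ φ x))
      ≤ ((1 + δ : ℝ≥0) : ℝ≥0∞) * (ENNReal.ofReal (graphJacobian A) * volume t) := by
    rw [← mul_assoc, ← setLIntegral_const]
    refine setLIntegral_mono measurable_const ?_
    intro x hx
    rw [hδ, ← ENNReal.ofReal_mul (by positivity)]
    refine ENNReal.ofReal_le_ofReal (graphJacobian_le_mul ?_)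
    rw [norm_sub_rev]; exact hA x hx
  rw [hlin] at h1 h2
  constructor
  · refine h1.trans ?_
    rw [pow_succ, mul_assoc]
    gcongr
  · refine i2.trans ?_
    rw [pow_succ', mul_assoc]
    gcongr

/-- The **area formula** for the graph of a Lipschitz function. -/
theorem euclideanHausdorffMeasure_graphMap_image {ι : (E × ℝ) ≃L[ℝ] V}
    (hι : ∀ p q, inner ℝ (ι p) (ι q) = inner ℝ p.1 q.1 + p.2 * q.2) {φ : E → ℝ} {L : ℝ≥0}
    (hφ : LipschitzWith L φ) {s : Set E} (hs : MeasurableSet s) :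
    (μHE[finrank ℝ E] : Measure V) (graphMap ι φ '' s)
      = ∫⁻ x in s, ENNReal.ofReal (graphJacobian (fderiv ℝ φ x)) := by
  set M : Measure E := (μHE[finrank ℝ E] : Measure V).comap (graphMap ι φ) with hM
  set N : Measure E := volume.withDensity
    fun x => ENNReal.ofReal (graphJacobian (fderiv ℝ φ x)) with hN
  have hemb := measurableEmbedding_graphMap ι hφ.continuous
  have hMs : ∀ t : Set E, M t = (μHE[finrank ℝ E] : Measure V) (graphMap ι φ '' t) :=
    fun t => hemb.comap_apply _ _
  have hNs : ∀ t : Set E, MeasurableSet t →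
      N t = ∫⁻ x in t, ENNReal.ofReal (graphJacobian (fderiv ℝ φ x)) :=
    fun t ht => withDensity_apply _ ht
  rw [← hMs, ← hNs s hs]
  set S : Set E := {x | DifferentiableAt ℝ φ x} with hS
  have hSm : MeasurableSet S := measurableSet_of_differentiableAt ℝ φ
  have hS0 : volume Sᶜ = 0 := hφ.ae_differentiableAt
  -- By Rademacher the bad set is Lebesgue null, and the graph map is Lipschitz, so its image is
  -- also null.
  have hM0 : M Sᶜ = 0 := by
    have := euclideanHausdorffMeasure_image_le_of_dist_le (finrank ℝ E) (t := Sᶜ) (g := id)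
      (f := graphMap ι φ) fun x _ y _ => dist_graphMap_le hι hφ x y
    rw [image_id, InnerProductSpace.euclideanHausdorffMeasure_eq_volume, hS0, mul_zero] at this
    rw [hMs]; exact nonpos_iff_eq_zero.1 this
  have hN0 : N Sᶜ = 0 := withDensity_absolutelyContinuous _ _ hS0
  have key : ∀ δ : ℝ≥0, 0 < δ →
      M (s ∩ S) ≤ ((1 + δ : ℝ≥0) : ℝ≥0∞) ^ (finrank ℝ E + 1) * N (s ∩ S) ∧
      N (s ∩ S) ≤ ((1 + δ : ℝ≥0) : ℝ≥0∞) ^ (finrank ℝ E + 1) * M (s ∩ S) := by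
    intro δ hδ
    obtain ⟨d, hd⟩ := TopologicalSpace.exists_dense_seq (E →L[ℝ] ℝ)
    -- The derivative oscillates by less than δ on each T k. This is needed because the partition
    -- below supplies linear maps equal to the derivative at some point of the piece, whereas
    -- `graph_area_piece` needs closeness at every point.
    set T : ℕ → Set E := fun k => S ∩ fderiv ℝ φ ⁻¹' Metric.ball (d k) (δ / 2) with hT
    have hTm : ∀ k, MeasurableSet (T k) := fun k =>
      hSm.inter (measurable_fderiv ℝ φ Metric.isOpen_ball.measurableSet)
    have hTc : s ∩ S ⊆ ⋃ k, T k := by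
      intro x hx
      obtain ⟨k, hk⟩ := hd.exists_mem_open (Metric.isOpen_ball (x := fderiv ℝ φ x) (ε := δ / 2))
        ⟨_, Metric.mem_ball_self (by positivity)⟩
      exact mem_iUnion.2 ⟨k, hx.2, by rwa [mem_preimage, Metric.mem_ball_comm]⟩
    have piece : ∀ k t, MeasurableSet t → t ⊆ T k →
        ∃ U : ℕ → Set E, (∀ j, MeasurableSet (U j)) ∧ t ⊆ ⋃ j, U j ∧
        ∀ j r, MeasurableSet r → r ⊆ t → r ⊆ U j →
          M r ≤ ((1 + δ : ℝ≥0) : ℝ≥0∞) ^ (finrank ℝ E + 1) * N r ∧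
          N r ≤ ((1 + δ : ℝ≥0) : ℝ≥0∞) ^ (finrank ℝ E + 1) * M r := by
      intro k t _ htk
      obtain ⟨U, A, -, hU, hcov, happ, hA⟩ :=
        exists_partition_approximatesLinearOn_of_hasFDerivWithinAt φ t (fderiv ℝ φ)
          (fun x hx => (htk hx).1.hasFDerivAt.hasFDerivWithinAt) (fun _ => δ) (fun _ => hδ.ne')
      refine ⟨U, hU, hcov, fun j r hr hrt hrU => ?_⟩
      rw [hMs, hNs r hr]
      refine graph_area_piece hι ((happ j).mono_set (subset_inter hrt hrU)) fun x hx => ?_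
      obtain ⟨y, hy, hAy⟩ := hA ⟨x, hrt hx⟩ j
      have h1 := (htk hy).2
      have h2 := (htk (hrt hx)).2
      rw [mem_preimage, Metric.mem_ball] at h1 h2
      rw [hAy, ← dist_eq_norm]
      linarith [dist_triangle_right (fderiv ℝ φ y) (fderiv ℝ φ x) (d k)]
    constructor
    · refine measure_le_mul_of_countable_cover hTm (hs.inter hSm) hTc fun k t ht _ htk => ?_
      obtain ⟨U, hU, hcov, h⟩ := piece k t ht htk
      exact measure_le_mul_of_countable_cover hU ht hcov fun j r hr hrt hrU =>
        (h j r hr hrt hrU).1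
    · refine measure_le_mul_of_countable_cover hTm (hs.inter hSm) hTc fun k t ht _ htk => ?_
      obtain ⟨U, hU, hcov, h⟩ := piece k t ht htk
      exact measure_le_mul_of_countable_cover hU ht hcov fun j r hr hrt hrU =>
        (h j r hr hrt hrU).2
  have lim : ∀ c : ℝ≥0∞, Filter.Tendsto
      (fun δ : ℝ≥0 => ((1 + δ : ℝ≥0) : ℝ≥0∞) ^ (finrank ℝ E + 1) * c) (𝓝[>] 0) (𝓝 c) := by
    intro c
    have h0 : Filter.Tendsto (fun δ : ℝ≥0 => ((1 + δ : ℝ≥0) : ℝ≥0∞) ^ (finrank ℝ E + 1))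
        (𝓝[>] 0) (𝓝 1) := by
      have : Continuous fun δ : ℝ≥0 => (((1 + δ) ^ (finrank ℝ E + 1) : ℝ≥0) : ℝ≥0∞) := by
        fun_prop
      have := this.tendsto 0
      simp only [add_zero, one_pow, ENNReal.coe_one, ENNReal.coe_pow] at this
      exact this.mono_left nhdsWithin_le_nhds
    simpa using ENNReal.Tendsto.mul_const h0 (Or.inl one_ne_zero)
  have hMS : M s = M (s ∩ S) := (measure_inter_conull hM0).symm
  have hNS : N s = N (s ∩ S) := (measure_inter_conull hN0).symm
  rw [hMS, hNS]
  refine le_antisymm (ge_of_tendsto (lim _) ?_) (ge_of_tendsto (lim _) ?_)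
  · filter_upwards [self_mem_nhdsWithin] with δ hδ using (key δ hδ).1
  · filter_upwards [self_mem_nhdsWithin] with δ hδ using (key δ hδ).2

theorem euclideanHausdorffMeasure_restrict_range_graphMap {ι : (E × ℝ) ≃L[ℝ] V}
    (hι : ∀ p q, inner ℝ (ι p) (ι q) = inner ℝ p.1 q.1 + p.2 * q.2) {φ : E → ℝ} {L : ℝ≥0}
    (hφ : LipschitzWith L φ) :
    (μHE[finrank ℝ E] : Measure V).restrict (range (graphMap ι φ))
      = (volume.withDensity fun x => ENNReal.ofReal (graphJacobian (fderiv ℝ φ x))).map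
        (graphMap ι φ) := by
  have hemb := measurableEmbedding_graphMap ι hφ.continuous
  ext s hs
  rw [hemb.map_apply, withDensity_apply _ (hemb.measurable hs),
    ← euclideanHausdorffMeasure_graphMap_image hι hφ (hemb.measurable hs),
    Measure.restrict_apply hs, image_preimage_eq_inter_range]

/-- The part of the graph in a ball lies over a ball of the same radius in E, and the graph map is
(1 + L)-Lipschitz. -/
theorem euclideanHausdorffMeasure_range_graphMap_inter_closedBall_le {ι : (E × ℝ) ≃L[ℝ] V}
    (hι : ∀ p q, inner ℝ (ι p) (ι q) = inner ℝ p.1 q.1 + p.2 * q.2) {φ : E → ℝ} {L : ℝ≥0}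
    (hφ : LipschitzWith L φ) (P : V) {r : ℝ} (hr : 0 ≤ r) :
    (μHE[finrank ℝ E] : Measure V) (range (graphMap ι φ) ∩ Metric.closedBall P r)
      ≤ ((1 + L : ℝ≥0) : ℝ≥0∞) ^ finrank ℝ E * volume (Metric.ball (0 : E) 1)
        * ENNReal.ofReal (r ^ finrank ℝ E) := by
  have hsub : range (graphMap ι φ) ∩ Metric.closedBall P r
      ⊆ graphMap ι φ '' Metric.closedBall (ι.symm P).1 r := by
    rintro _ ⟨⟨x, rfl⟩, hx⟩
    refine ⟨x, ?_, rfl⟩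
    rw [Metric.mem_closedBall, dist_eq_norm] at hx ⊢
    refine le_trans ?_ hx
    have := norm_fst_le_graphCoord hι ((x, φ x) - ι.symm P)
    rwa [map_sub, ι.apply_symm_apply] at this
  refine (measure_mono hsub).trans ?_
  have := euclideanHausdorffMeasure_image_le_of_dist_le (finrank ℝ E)
    (t := Metric.closedBall (ι.symm P).1 r) (g := id)
    (f := graphMap ι φ) fun x _ y _ => dist_graphMap_le hι hφ x y
  rw [image_id, InnerProductSpace.euclideanHausdorffMeasure_eq_volume,
    Measure.addHaar_closedBall _ _ hr] at this
  refine this.trans (le_of_eq ?_)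
  ring

end AreaFormula

/-! ### Divergence theorem above a Lipschitz graph -/

section GraphDivergence

open Module Set

variable {E : Type*} [NormedAddCommGroup E] [InnerProductSpace ℝ E] [FiniteDimensional ℝ E]
  [MeasurableSpace E] [BorelSpace E]

/-- The vertical shear which straightens the graph of `φ`. -/
def graphShear {φ : E → ℝ} (hφ : Continuous φ) : (E × ℝ) ≃ₜ (E × ℝ) where
  toFun p := (p.1, φ p.1 + p.2)
  invFun p := (p.1, p.2 - φ p.1)
  left_inv p := by simp
  right_inv p := by simp
  continuous_toFun := by fun_prop
  continuous_invFun := by fun_prop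

theorem measurePreserving_graphShear {φ : E → ℝ} (hφ : Continuous φ) :
    MeasurePreserving (graphShear hφ) := by
  refine (MeasurePreserving.id (volume : Measure E)).skew_product
    (g := fun x s => φ x + s) (μc := volume) (μd := volume) ?_ ?_
  · exact (by fun_prop : Continuous (Function.uncurry fun x s => φ x + s)).measurable
  · exact Filter.Eventually.of_forall fun x => (measurePreserving_add_left volume (φ x)).map_eq

/-- Integration by parts against the constant function 1. -/
theorem integral_lineDeriv_eq_zero {g : E → ℝ} {C : ℝ≥0} (hg : LipschitzWith C g)
    (h : HasCompactSupport g) (e : E) : ∫ x, lineDeriv ℝ g x e = 0 := by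
  have := (LipschitzWith.const (1 : ℝ) : LipschitzWith 0 fun _ : E => (1 : ℝ)).integral_lineDeriv_mul_eq
    (μ := volume) hg h (-e)
  simp only [neg_neg, mul_one] at this
  rw [← this]
  simp [lineDeriv]

/-- The divergence theorem on the region above a Lipschitz graph. -/
theorem setIntegral_epigraph_fderiv {φ : E → ℝ} {L : ℝ≥0} (hφ : LipschitzWith L φ)
    {v : E × ℝ → ℝ} (hv : ContDiff ℝ 1 v) (hc : HasCompactSupport v) (e : E × ℝ) :
    ∫ p in {p : E × ℝ | φ p.1 < p.2}, fderiv ℝ v p e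
      = ∫ x, (fderiv ℝ φ x e.1 - e.2) * v (x, φ x) := by
  set Ψ := graphShear hφ.continuous with hΨ
  have hmp : MeasurePreserving Ψ := measurePreserving_graphShear hφ.continuous
  have hdv : Continuous (fderiv ℝ v) := hv.continuous_fderiv one_ne_zero
  have hdc : HasCompactSupport (fderiv ℝ v) := hc.fderiv ℝ
  have hint : ∀ w : E × ℝ, Integrable (fun q => fderiv ℝ v (Ψ q) w) := fun w => by
    refine Continuous.integrable_of_hasCompactSupport (by fun_prop) ?_
    exact (hdc.comp_homeomorph Ψ).comp_left (g := fun A : E × ℝ →L[ℝ] ℝ => A w) rfl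
  set c : E → ℝ := fun x => fderiv ℝ φ x e.1 with hcdef
  have hcm : Measurable c := (measurable_fderiv ℝ φ).apply_continuousLinearMap e.1
  -- Valid at every point: where φ is not differentiable its `fderiv` is 0.
  have hcb : ∀ x, ‖c x‖ ≤ L * ‖e.1‖ := fun x =>
    ((fderiv ℝ φ x).le_opNorm e.1).trans
      (mul_le_mul_of_nonneg_right (norm_fderiv_le_of_lipschitz ℝ hφ) (norm_nonneg _))
  -- The direction e splits into (e.1, ∇φ·e.1), tangent to the translated graphs, and a vertical
  -- remainder. On each slice of fixed s, G1 is a.e. the derivative along e.1 of the compactly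
  -- supported Lipschitz function x ↦ v(x, φ x + s), so it integrates to 0; G2 is integrated in s by
  -- the fundamental theorem of calculus.
  set G1 : E × ℝ → ℝ := fun q => fderiv ℝ v (Ψ q) (e.1, 0) + c q.1 * fderiv ℝ v (Ψ q) (0, 1)
  set G2 : E × ℝ → ℝ := fun q => (e.2 - c q.1) * fderiv ℝ v (Ψ q) (0, 1)
  have hG1 : Integrable G1 := by
    refine (hint _).add ((hint _).bdd_mul (c := L * ‖e.1‖) ?_ ?_)
    · exact (hcm.comp measurable_fst).aestronglyMeasurable
    · exact Filter.Eventually.of_forall fun q => hcb q.1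
  have hG2 : Integrable G2 := by
    refine (hint _).bdd_mul (c := |e.2| + L * ‖e.1‖) ?_ ?_
    · exact ((hcm.comp measurable_fst).const_sub e.2).aestronglyMeasurable
    · exact Filter.Eventually.of_forall fun q => (norm_sub_le _ _).trans
        (add_le_add le_rfl (hcb q.1))
  have hsplit : ∀ q, fderiv ℝ v (Ψ q) e = G1 q + G2 q := fun q => by
    have : e = (e.1, 0) + e.2 • ((0 : E), (1 : ℝ)) := by ext <;> simp
    simp only [G1, G2]
    conv_lhs => rw [this, map_add, map_smul, smul_eq_mul]
    ring
  have hset : Ψ ⁻¹' {p : E × ℝ | φ p.1 < p.2} = univ ×ˢ Ioi (0 : ℝ) := by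
    ext q; simp [hΨ, graphShear]
  rw [← hmp.setIntegral_preimage_emb Ψ.measurableEmbedding, hset]
  simp_rw [hsplit]
  rw [integral_add hG1.integrableOn hG2.integrableOn]
  have hprod : (volume : Measure (E × ℝ)).restrict (univ ×ˢ Ioi (0 : ℝ))
      = (volume : Measure E).prod ((volume : Measure ℝ).restrict (Ioi 0)) := by
    rw [Measure.volume_eq_prod, ← Measure.prod_restrict, Measure.restrict_univ]
  have z1 : ∫ q in univ ×ˢ Ioi (0 : ℝ), G1 q = 0 := by
    have hi : IntegrableOn G1 (univ ×ˢ Ioi (0 : ℝ)) := hG1.integrableOn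
    rw [IntegrableOn, hprod] at hi
    rw [hprod, integral_prod_symm _ hi]
    refine integral_eq_zero_of_ae (Filter.Eventually.of_forall fun s => ?_)
    have hls : LipschitzWith L fun x => φ x + s := by
      simpa using hφ.add (LipschitzWith.const s)
    obtain ⟨C, hC⟩ := hv.lipschitzWith_of_hasCompactSupport hc one_ne_zero
    have hlip := hC.comp (LipschitzWith.id.prodMk hls)
    have hcs : HasCompactSupport (v ∘ fun x => (x, φ x + s)) :=
      hc.comp_isClosedEmbedding (isClosedEmbedding_prodMk_graph hls.continuous)
    change ∫ x, G1 (x, s) = 0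
    rw [← integral_lineDeriv_eq_zero hlip hcs e.1]
    refine integral_congr_ae ?_
    filter_upwards [hφ.ae_differentiableAt] with x hx
    have h1 : HasFDerivAt (fun x => (x, φ x + s))
        ((ContinuousLinearMap.id ℝ E).prod (fderiv ℝ φ x)) x :=
      (hasFDerivAt_id x).prodMk (hx.hasFDerivAt.add_const s)
    have h2 := ((hv.differentiable one_ne_zero).differentiableAt
      (x := (x, φ x + s))).hasFDerivAt.comp x h1
    have h3 := (h2.hasLineDerivAt e.1).lineDeriv
    refine Eq.trans ?_ h3.symm
    simp only [G1, ContinuousLinearMap.comp_apply, ContinuousLinearMap.prod_apply,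
      ContinuousLinearMap.id_apply]
    have : (e.1, fderiv ℝ φ x e.1) = (e.1, 0) + c x • ((0 : E), (1 : ℝ)) := by ext <;> simp [c]
    rw [this, map_add, map_smul, smul_eq_mul]
    rfl
  have z2 : ∫ q in univ ×ˢ Ioi (0 : ℝ), G2 q = ∫ x, (c x - e.2) * v (x, φ x) := by
    have hi : IntegrableOn G2 (univ ×ˢ Ioi (0 : ℝ)) := hG2.integrableOn
    rw [IntegrableOn, hprod] at hi
    rw [hprod, integral_prod _ hi]
    refine integral_congr_ae (Filter.Eventually.of_forall fun x => ?_)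
    have hcd : ContDiff ℝ 1 fun s : ℝ => v (x, φ x + s) := by fun_prop
    have hcs : HasCompactSupport fun s : ℝ => v (x, φ x + s) := by
      have hemb : Topology.IsClosedEmbedding fun s : ℝ => (x, φ x + s) :=
        Ψ.isClosedEmbedding.comp ⟨isEmbedding_prodMkRight x, by
          have : range (Prod.mk x) = {x} ×ˢ (univ : Set ℝ) := by
            ext ⟨y, s⟩; simp [eq_comm]
          rw [this]
          exact isClosed_singleton.prod isClosed_univ⟩
      exact hc.comp_isClosedEmbedding hemb
    have h1 := hcs.integral_Ioi_deriv_eq hcd 0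
    have h2 : ∀ s, deriv (fun s : ℝ => v (x, φ x + s)) s = fderiv ℝ v (Ψ (x, s)) (0, 1) := by
      intro s
      have h1 : HasDerivAt (fun s : ℝ => (x, φ x + s)) ((0 : E), (1 : ℝ)) s :=
        (hasDerivAt_const s x).prodMk ((hasDerivAt_id s).const_add (φ x))
      exact (((hv.differentiable one_ne_zero).differentiableAt
        (x := (x, φ x + s))).hasFDerivAt.comp_hasDerivAt s h1).deriv
    simp_rw [h2, add_zero] at h1
    change ∫ s in Ioi 0, (e.2 - c x) * fderiv ℝ v (Ψ (x, s)) (0, 1) = _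
    rw [integral_const_mul, h1]
    ring
  rw [z1, z2, zero_add]

end GraphDivergence

/-! ### Graph charts: boundary, surface measure and normal -/

section Charts

open Module Set

/-- The standard coordinates `ℝ^n × ℝ ≃ ℝ^{n+1}`. -/
noncomputable def euclideanSnoc (n : ℕ) :
    (EuclideanSpace ℝ (Fin n) × ℝ) ≃L[ℝ] EuclideanSpace ℝ (Fin (n + 1)) :=
  LinearEquiv.toContinuousLinearEquiv
    { toFun := fun p => WithLp.toLp 2 (Fin.snoc (α := fun _ => ℝ) p.1 p.2)
      invFun := fun X => (WithLp.toLp 2 fun i : Fin n => X i.castSucc, X (Fin.last n))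
      map_add' := fun p q => by
        ext i; refine Fin.lastCases ?_ (fun i => ?_) i <;> simp
      map_smul' := fun c p => by
        ext i; refine Fin.lastCases ?_ (fun i => ?_) i <;> simp
      left_inv := fun p => by ext <;> simp
      right_inv := fun X => by
        ext i; refine Fin.lastCases ?_ (fun i => ?_) i <;> simp }

theorem euclideanSnoc_symm_apply (n : ℕ) (X : EuclideanSpace ℝ (Fin (n + 1))) :
    (euclideanSnoc n).symm X
      = (WithLp.toLp 2 fun i : Fin n => X i.castSucc, X (Fin.last n)) := rfl

theorem inner_euclideanSnoc {n : ℕ} (p q : EuclideanSpace ℝ (Fin n) × ℝ) :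
    inner ℝ (euclideanSnoc n p) (euclideanSnoc n q) = inner ℝ p.1 q.1 + p.2 * q.2 := by
  change inner ℝ (WithLp.toLp 2 (Fin.snoc (α := fun _ => ℝ) p.1 p.2))
    (WithLp.toLp 2 (Fin.snoc (α := fun _ => ℝ) q.1 q.2)) = _
  simp [PiLp.inner_apply, Fin.sum_univ_castSucc, mul_comm]

theorem measurePreserving_euclideanSnoc (n : ℕ) : MeasurePreserving (euclideanSnoc n) := by
  have h1 : MeasurePreserving (MeasurableEquiv.piFinSuccAbove (fun _ : Fin (n + 1) => ℝ)
      (Fin.last n)) := volume_preserving_piFinSuccAbove (fun _ => ℝ) (Fin.last n)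
  have h2 : MeasurePreserving (Prod.swap : ℝ × (Fin n → ℝ) → (Fin n → ℝ) × ℝ) :=
    Measure.measurePreserving_swap
  have h3 : MeasurePreserving
      (Prod.map (WithLp.toLp 2) id : (Fin n → ℝ) × ℝ → EuclideanSpace ℝ (Fin n) × ℝ) :=
    (PiLp.volume_preserving_toLp (Fin n)).prod
      (MeasurePreserving.id volume)
  have h4 := h3.comp (h2.comp (h1.comp
    (PiLp.volume_preserving_ofLp (Fin (n + 1)))))
  have h5 : MeasurePreserving (euclideanSnoc n).symm := by
    convert h4 using 1
    ext X <;> simp [euclideanSnoc_symm_apply, MeasurableEquiv.piFinSuccAbove, Fin.init]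
  exact h5.symm (euclideanSnoc n).symm.toHomeomorph.toMeasurableEquiv

/-- In the coordinates `ι` and inside the open set `U`, the set `D` is the region above the graph
of the Lipschitz function `φ`. -/
structure IsGraphChart {n : ℕ} (D U : Set (EuclideanSpace ℝ (Fin (n + 1))))
    (ι : (EuclideanSpace ℝ (Fin n) × ℝ) ≃L[ℝ] EuclideanSpace ℝ (Fin (n + 1)))
    (φ : EuclideanSpace ℝ (Fin n) → ℝ) (L : ℝ≥0) : Prop where
  isOpen : IsOpen U
  inner_eq : ∀ p q, inner ℝ (ι p) (ι q) = inner ℝ p.1 q.1 + p.2 * q.2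
  measurePreserving : MeasurePreserving ι
  lipschitz : LipschitzWith L φ
  mem_iff : ∀ X ∈ U, X ∈ D ↔ φ (ι.symm X).1 < (ι.symm X).2

theorem IsBoundedLipschitzDomain.exists_isGraphChart {n : ℕ}
    {D : Set (EuclideanSpace ℝ (Fin (n + 1)))} (hD : IsBoundedLipschitzDomain n D)
    {P : EuclideanSpace ℝ (Fin (n + 1))} (hP : P ∈ frontier D) :
    ∃ r : ℝ, 0 < r ∧ ∃ ι φ L, IsGraphChart D (Metric.ball P r) ι φ L := by
  obtain ⟨r, hr, R, φ, L, hφ, h⟩ := hD.locally_graph P hP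
  refine ⟨r, hr, (euclideanSnoc n).trans R.symm.toContinuousLinearEquiv, φ, L,
    Metric.isOpen_ball, fun p q => ?_, ?_, hφ, h⟩
  · rw [← inner_euclideanSnoc p q]
    exact R.symm.inner_map_map _ _
  · exact R.symm.measurePreserving.comp (measurePreserving_euclideanSnoc n)

namespace IsGraphChart

variable {n : ℕ} {D U : Set (EuclideanSpace ℝ (Fin (n + 1)))}
  {ι : (EuclideanSpace ℝ (Fin n) × ℝ) ≃L[ℝ] EuclideanSpace ℝ (Fin (n + 1))}
  {φ : EuclideanSpace ℝ (Fin n) → ℝ} {L : ℝ≥0}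

theorem graphMap_mem_frontier (h : IsGraphChart D U ι φ L) {x : EuclideanSpace ℝ (Fin n)}
    (hx : graphMap ι φ x ∈ U) : graphMap ι φ x ∈ frontier D := by
  have hnot : graphMap ι φ x ∉ D := by
    rw [h.mem_iff _ hx]; simp [graphMap]
  refine ⟨?_, fun hi => hnot (interior_subset hi)⟩
  have ht : Filter.Tendsto (fun s : ℝ => ι (x, φ x + s)) (𝓝[>] 0) (𝓝 (graphMap ι φ x)) := by
    have : Continuous fun s : ℝ => ι (x, φ x + s) := by fun_prop
    have := this.tendsto 0
    rw [add_zero] at this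
    exact this.mono_left nhdsWithin_le_nhds
  refine mem_closure_of_tendsto ht ?_
  filter_upwards [ht.eventually (h.isOpen.mem_nhds hx), self_mem_nhdsWithin] with s hs hs0
  rw [h.mem_iff _ hs]
  simpa using hs0

theorem frontier_inter (h : IsGraphChart D U ι φ L) :
    frontier D ∩ U = range (graphMap ι φ) ∩ U := by
  ext X
  refine ⟨fun ⟨hX, hU⟩ => ⟨?_, hU⟩, ?_⟩
  · have hs : D ∩ U = (ι.symm ⁻¹' {p | φ p.1 < p.2}) ∩ U := by
      ext Y
      exact ⟨fun hY => ⟨(h.mem_iff Y hY.2).1 hY.1, hY.2⟩,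
        fun hY => ⟨(h.mem_iff Y hY.2).2 hY.1, hY.2⟩⟩
    have hX2 : X ∈ frontier (ι.symm ⁻¹' {p | φ p.1 < p.2}) := by
      have : X ∈ frontier D ∩ U := ⟨hX, hU⟩
      rw [← frontier_inter_open_inter h.isOpen, hs, frontier_inter_open_inter h.isOpen] at this
      exact this.1
    have hpre := ι.symm.toHomeomorph.preimage_frontier {p | φ p.1 < p.2}
    change ι.symm ⁻¹' _ = frontier (ι.symm ⁻¹' _) at hpre
    rw [← hpre] at hX2
    have hX3 : φ (ι.symm X).1 = (ι.symm X).2 :=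
      frontier_lt_subset_eq (h.lipschitz.continuous.comp continuous_fst) continuous_snd hX2
    refine ⟨(ι.symm X).1, ?_⟩
    rw [graphMap, hX3]
    exact ι.apply_symm_apply X
  · rintro ⟨⟨x, rfl⟩, hU⟩
    exact ⟨h.graphMap_mem_frontier hU, hU⟩

/-- The measure `√(1 + |∇φ|²) dx`. -/
noncomputable def _root_.graphAreaMeasure {n : ℕ} (φ : EuclideanSpace ℝ (Fin n) → ℝ) :
    Measure (EuclideanSpace ℝ (Fin n)) :=
  volume.withDensity fun x => ENNReal.ofReal (graphJacobian (fderiv ℝ φ x))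

theorem restrict_range (h : IsGraphChart D U ι φ L) :
    (μHE[n] : Measure (EuclideanSpace ℝ (Fin (n + 1)))).restrict (range (graphMap ι φ))
      = (graphAreaMeasure φ).map (graphMap ι φ) := by
  have := euclideanHausdorffMeasure_restrict_range_graphMap h.inner_eq h.lipschitz
  rwa [finrank_euclideanSpace_fin] at this

/-- Turns surface integrals of functions supported in U into integrals over ℝⁿ. -/
theorem surfaceMeasure_restrict (h : IsGraphChart D U ι φ L) :
    (surfaceMeasure n D).restrict U = ((graphAreaMeasure φ).map (graphMap ι φ)).restrict U := by
  rw [← h.restrict_range, surfaceMeasure, Measure.restrict_restrict h.isOpen.measurableSet,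
    Measure.restrict_restrict h.isOpen.measurableSet, inter_comm, h.frontier_inter, inter_comm]

/-- The unit normal to the graph of `φ`, as a function on the ambient space. -/
noncomputable def _root_.graphNormal {n : ℕ}
    (ι : (EuclideanSpace ℝ (Fin n) × ℝ) ≃L[ℝ] EuclideanSpace ℝ (Fin (n + 1)))
    (φ : EuclideanSpace ℝ (Fin n) → ℝ) (x : EuclideanSpace ℝ (Fin n)) :
    EuclideanSpace ℝ (Fin (n + 1)) :=
  (graphJacobian (fderiv ℝ φ x))⁻¹ •
    ι ((InnerProductSpace.toDual ℝ _).symm (fderiv ℝ φ x), -1)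

theorem _root_.measurable_graphNormal
    (ι : (EuclideanSpace ℝ (Fin n) × ℝ) ≃L[ℝ] EuclideanSpace ℝ (Fin (n + 1)))
    (φ : EuclideanSpace ℝ (Fin n) → ℝ) : Measurable (graphNormal ι φ) := by
  refine (measurable_graphJacobian_fderiv φ).inv.smul (ι.continuous.measurable.comp ?_)
  exact (((InnerProductSpace.toDual ℝ _).symm.continuous.measurable.comp
    (measurable_fderiv ℝ φ))).prodMk measurable_const

theorem inner_graphNormal (h : IsGraphChart D U ι φ L) (x : EuclideanSpace ℝ (Fin n))
    (e : EuclideanSpace ℝ (Fin (n + 1))) :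
    inner ℝ (graphNormal ι φ x) e = (graphJacobian (fderiv ℝ φ x))⁻¹ *
      (fderiv ℝ φ x (ι.symm e).1 - (ι.symm e).2) := by
  conv_lhs => rw [← ι.apply_symm_apply e]
  rw [graphNormal, real_inner_smul_left, h.inner_eq, InnerProductSpace.toDual_symm_apply]
  simp only [neg_mul, one_mul, sub_eq_add_neg]

/-- Up to the factor J = √(1 + |∇φ|²), the inner product with the normal is minus the height above
the tangent plane; differentiability makes the graph deviate from that plane by at most ε times the
distance. -/
theorem isOuterUnitNormal (h : IsGraphChart D U ι φ L) {x : EuclideanSpace ℝ (Fin n)}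
    (hx : graphMap ι φ x ∈ U) (hd : DifferentiableAt ℝ φ x) :
    IsOuterUnitNormal D (graphMap ι φ x) (graphNormal ι φ x) := by
  have hJ := graphJacobian_pos (fderiv ℝ φ x)
  have hJ1 := one_le_graphJacobian (fderiv ℝ φ x)
  refine ⟨?_, fun ε hε => ?_⟩
  · rw [graphNormal, norm_smul, norm_inv, Real.norm_of_nonneg hJ.le, inv_mul_eq_one₀ hJ.ne']
    have := norm_sq_graphCoord h.inner_eq
      ((InnerProductSpace.toDual ℝ _).symm (fderiv ℝ φ x), (-1 : ℝ))
    rw [graphJacobian, ← Real.sqrt_sq (norm_nonneg (ι _)), this]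
    congr 1
    simp [add_comm]
  · have hlit := hd.hasFDerivAt.isLittleO.def hε
    have hproj : Filter.Tendsto (fun X => (ι.symm X).1) (𝓝 (graphMap ι φ x)) (𝓝 x) := by
      have : Continuous fun X => (ι.symm X).1 := by fun_prop
      simpa [graphMap] using this.tendsto (graphMap ι φ x)
    filter_upwards [hproj.eventually hlit, h.isOpen.mem_nhds hx] with X hX hXU
    have hn : ‖(ι.symm X).1 - x‖ ≤ ‖X - graphMap ι φ x‖ := by
      have := norm_fst_le_graphCoord h.inner_eq (ι.symm X - (x, φ x))
      rwa [map_sub, ι.apply_symm_apply] at this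
    have hb : |φ (ι.symm X).1 - φ x - fderiv ℝ φ x ((ι.symm X).1 - x)|
        ≤ ε * ‖X - graphMap ι φ x‖ := hX.trans (by gcongr)
    have hi : inner ℝ (X - graphMap ι φ x) (graphNormal ι φ x)
        = (graphJacobian (fderiv ℝ φ x))⁻¹ *
          (fderiv ℝ φ x ((ι.symm X).1 - x) - ((ι.symm X).2 - φ x)) := by
      rw [real_inner_comm, h.inner_graphNormal]
      simp [graphMap]
    have hεn : 0 ≤ ε * ‖X - graphMap ι φ x‖ := by positivity
    -- J ≥ 1 lets the same ε serve after multiplying the cone inequality through by J.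
    have hle : ε * ‖X - graphMap ι φ x‖
        ≤ graphJacobian (fderiv ℝ φ x) * (ε * ‖X - graphMap ι φ x‖) :=
      le_mul_of_one_le_left hεn hJ1
    rw [abs_le] at hb
    rw [hi, h.mem_iff X hXU]
    constructor
    · intro hlt
      rw [inv_mul_lt_iff₀ hJ] at hlt
      linarith
    · intro hlt
      rw [lt_inv_mul_iff₀ hJ] at hlt
      linarith

theorem outerNormal_graphMap (h : IsGraphChart D U ι φ L) {x : EuclideanSpace ℝ (Fin n)}
    (hx : graphMap ι φ x ∈ U) (hd : DifferentiableAt ℝ φ x) :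
    outerNormal D (graphMap ι φ x) = graphNormal ι φ x := by
  have hex : ∃ ν, IsOuterUnitNormal D (graphMap ι φ x) ν := ⟨_, h.isOuterUnitNormal hx hd⟩
  rw [outerNormal, dif_pos hex]
  exact hex.choose_spec.unique (h.isOuterUnitNormal hx hd)

theorem ae_outerNormal_eq (h : IsGraphChart D U ι φ L) :
    ∀ᵐ x ∂graphAreaMeasure φ, graphMap ι φ x ∈ U →
      outerNormal D (graphMap ι φ x) = graphNormal ι φ x := by
  refine (withDensity_absolutelyContinuous _ _).ae_le ?_
  filter_upwards [h.lipschitz.ae_differentiableAt] with x hd hx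
  exact h.outerNormal_graphMap hx hd

theorem aestronglyMeasurable_outerNormal (h : IsGraphChart D U ι φ L) :
    AEStronglyMeasurable (outerNormal D) ((surfaceMeasure n D).restrict U) := by
  refine AEStronglyMeasurable.congr (f := fun X => graphNormal ι φ (ι.symm X).1) ?_ ?_
  · refine ((measurable_graphNormal ι φ).comp ?_).aestronglyMeasurable
    exact (by fun_prop : Continuous fun X => (ι.symm X).1).measurable
  · rw [h.surfaceMeasure_restrict]
    refine (ae_restrict_iff' h.isOpen.measurableSet).2 ?_
    rw [(measurableEmbedding_graphMap ι h.lipschitz.continuous).ae_map_iff]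
    filter_upwards [h.ae_outerNormal_eq] with x hx hU
    rw [hx hU]
    simp [graphMap]

theorem surfaceMeasure_inter_closedBall_le (h : IsGraphChart D U ι φ L) :
    ∃ C : ℝ≥0, ∀ (P : EuclideanSpace ℝ (Fin (n + 1))) (r : ℝ), 0 ≤ r →
      surfaceMeasure n D (U ∩ Metric.closedBall P r) ≤ C * ENNReal.ofReal (r ^ n) := by
  refine ⟨(1 + L) ^ n * (volume (Metric.ball (0 : EuclideanSpace ℝ (Fin n)) 1)).toNNReal,
    fun P r hr => ?_⟩
  have := euclideanHausdorffMeasure_range_graphMap_inter_closedBall_le h.inner_eq h.lipschitz P hr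
  rw [finrank_euclideanSpace_fin] at this
  rw [surfaceMeasure, Measure.restrict_apply
    (h.isOpen.measurableSet.inter Metric.isClosed_closedBall.measurableSet)]
  refine le_trans (measure_mono ?_) (this.trans (le_of_eq ?_))
  · rintro X ⟨⟨hU, hX⟩, hf⟩
    have : X ∈ range (graphMap ι φ) ∩ U := h.frontier_inter ▸ ⟨hf, hU⟩
    exact ⟨this.1, hX⟩
  · rw [ENNReal.coe_mul, ENNReal.coe_toNNReal measure_ball_lt_top.ne, ENNReal.coe_pow]

/-- The density J of surface measure cancels the normalization J⁻¹ of the normal, leaving exactly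
the boundary term of `setIntegral_epigraph_fderiv`. Outside U everything vanishes, so the graph
there need not bound D. -/
theorem setIntegral_fderiv (h : IsGraphChart D U ι φ L)
    {u : EuclideanSpace ℝ (Fin (n + 1)) → ℝ} (hu : ContDiff ℝ 1 u) (hc : HasCompactSupport u)
    (hU : tsupport u ⊆ U) (hD : MeasurableSet D) (e : EuclideanSpace ℝ (Fin (n + 1))) :
    ∫ X in D, fderiv ℝ u X e = ∫ P, inner ℝ (outerNormal D P) e * u P ∂surfaceMeasure n D := by
  have hemb := measurableEmbedding_graphMap ι h.lipschitz.continuous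
  have hu0 : ∀ X, X ∉ U → u X = 0 := fun X hX => image_eq_zero_of_notMem_tsupport fun h' => hX (hU h')
  have hdu0 : ∀ X, X ∉ U → fderiv ℝ u X = 0 := fun X hX =>
    image_eq_zero_of_notMem_tsupport fun h' => hX (hU (tsupport_fderiv_subset ℝ h'))
  have hem : MeasurableSet {p : EuclideanSpace ℝ (Fin n) × ℝ | φ p.1 < p.2} :=
    (isOpen_lt (h.lipschitz.continuous.comp continuous_fst) continuous_snd).measurableSet
  have hι := ι.toHomeomorph.measurableEmbedding
  have lhs : ∫ X in D, fderiv ℝ u X e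
      = ∫ p in {p : EuclideanSpace ℝ (Fin n) × ℝ | φ p.1 < p.2},
          fderiv ℝ (u ∘ ι) p (ι.symm e) := by
    rw [← integral_indicator hD, ← h.measurePreserving.integral_comp hι, ← integral_indicator hem]
    refine integral_congr_ae (Filter.Eventually.of_forall fun p => ?_)
    have hfd : fderiv ℝ (u ∘ ι) p (ι.symm e) = fderiv ℝ u (ι p) e := by
      rw [ι.comp_right_fderiv]; simp
    by_cases hp : ι p ∈ U
    · have := h.mem_iff _ hp
      rw [ι.symm_apply_apply] at this
      simp only [indicator, hfd, this, mem_ofPred_eq]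
    · simp only [indicator, hfd, hdu0 _ hp, FunLike.coe_zero, Pi.zero_apply, ite_self]
  have rhs : ∫ P, inner ℝ (outerNormal D P) e * u P ∂surfaceMeasure n D
      = ∫ x, (fderiv ℝ φ x (ι.symm e).1 - (ι.symm e).2) * u (graphMap ι φ x) := by
    have hz : ∀ X, X ∉ U → inner ℝ (outerNormal D X) e * u X = 0 := fun X hX => by
      rw [hu0 X hX, mul_zero]
    rw [← setIntegral_eq_integral_of_forall_compl_eq_zero hz, h.surfaceMeasure_restrict,
      setIntegral_eq_integral_of_forall_compl_eq_zero hz, hemb.integral_map]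
    have : ∫ x, inner ℝ (outerNormal D (graphMap ι φ x)) e * u (graphMap ι φ x)
          ∂graphAreaMeasure φ
        = ∫ x, inner ℝ (graphNormal ι φ x) e * u (graphMap ι φ x) ∂graphAreaMeasure φ := by
      refine integral_congr_ae ?_
      filter_upwards [h.ae_outerNormal_eq] with x hx
      by_cases hxU : graphMap ι φ x ∈ U
      · rw [hx hxU]
      · rw [hu0 _ hxU, mul_zero, mul_zero]
    rw [this, graphAreaMeasure, integral_withDensity_eq_integral_toReal_smul
      (measurable_graphJacobian_fderiv φ).ennreal_ofReal
      (Filter.Eventually.of_forall fun _ => ENNReal.ofReal_lt_top)]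
    refine integral_congr_ae (Filter.Eventually.of_forall fun x => ?_)
    have hJ := graphJacobian_pos (fderiv ℝ φ x)
    simp only [ENNReal.toReal_ofReal hJ.le, smul_eq_mul, h.inner_graphNormal]
    field_simp
  rw [lhs, rhs]
  exact setIntegral_epigraph_fderiv h.lipschitz (hu.comp ι.contDiff)
    (hc.comp_homeomorph ι.toHomeomorph) (ι.symm e)

end IsGraphChart

end Charts

/-! ### Divergence theorem and Ahlfors bound on a bounded Lipschitz domain -/

section LipschitzDomain

open Module Set

theorem norm_outerNormal_le {n : ℕ} (D : Set (EuclideanSpace ℝ (Fin (n + 1))))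
    (P : EuclideanSpace ℝ (Fin (n + 1))) : ‖outerNormal D P‖ ≤ 1 := by
  rw [outerNormal]
  split_ifs with h
  · exact h.choose_spec.1.le
  · simp

/-- Gluing local forms of the divergence theorem by a partition of unity. -/
theorem setIntegral_fderiv_of_local {V : Type*} [NormedAddCommGroup V] [InnerProductSpace ℝ V]
    [FiniteDimensional ℝ V] [MeasurableSpace V] [BorelSpace V] {D : Set V} (hD : IsOpen D)
    (hb : Bornology.IsBounded D) {σ : Measure V} [IsFiniteMeasure σ] (hσ : ∀ᵐ P ∂σ, P ∈ closure D)
    {w : V → ℝ} (hwm : AEStronglyMeasurable w σ) {c : ℝ} (hw : ∀ P, ‖w P‖ ≤ c) (e : V)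
    (hloc : ∀ X ∈ closure D, ∃ r : ℝ, 0 < r ∧ ∀ u : V → ℝ, ContDiff ℝ 1 u → HasCompactSupport u →
      tsupport u ⊆ Metric.ball X r → ∫ X in D, fderiv ℝ u X e = ∫ P, w P * u P ∂σ)
    {u : V → ℝ} (hu : ContDiff ℝ 1 u) :
    ∫ X in D, fderiv ℝ u X e = ∫ P, w P * u P ∂σ := by
  choose! r hr0 hr using hloc
  have hcomp : IsCompact (closure D) := hb.isCompact_closure
  obtain ⟨t, htD, htc⟩ := hcomp.elim_nhds_subcover (fun X => Metric.ball X (r X))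
    fun X hX => Metric.ball_mem_nhds X (hr0 X hX)
  obtain ⟨f, hf⟩ := SmoothPartitionOfUnity.exists_isSubordinate (modelWithCornersSelf ℝ V)
    (isClosed_closure (s := D)) (fun i : t => Metric.ball (i : V) (r i))
    (fun i => Metric.isOpen_ball) (by simpa [iUnion_subtype] using htc)
  have hsum : ∀ X ∈ closure D, ∑ i, f i X * u X = u X := fun X hX => by
    rw [← Finset.sum_mul, ← finsum_eq_sum_of_fintype, f.sum_eq_one hX, one_mul]
  have hfc : ∀ i, ContDiff ℝ 1 (fun X => f i X * u X) := fun i =>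
    (((f i).contMDiff.contDiff).of_le (by simp)).mul hu
  have hts : ∀ i, tsupport (fun X => f i X * u X) ⊆ Metric.ball (i : V) (r i) := fun i =>
    (closure_mono (Function.support_mul_subset_left _ _)).trans (hf i)
  have hcs : ∀ i, HasCompactSupport (fun X => f i X * u X) := fun i =>
    Metric.isCompact_of_isClosed_isBounded (isClosed_tsupport _)
      (Metric.isBounded_ball.subset (hts i))
  have hi : ∀ i, ∫ X in D, fderiv ℝ (fun X => f i X * u X) X e
      = ∫ P, w P * (f i P * u P) ∂σ := fun i =>
    hr i (htD i i.2) _ (hfc i) (hcs i) (hts i)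
  have lhs : ∫ X in D, fderiv ℝ u X e
      = ∫ X in D, ∑ i, fderiv ℝ (fun X => f i X * u X) X e := by
    refine setIntegral_congr_fun hD.measurableSet fun X hX => ?_
    -- The weights sum to 1 only on the closure of D; openness of D gives the identity near X, which
    -- is what differentiation needs.
    have hev : u =ᶠ[𝓝 X] fun Y => ∑ i, f i Y * u Y := by
      filter_upwards [hD.mem_nhds hX] with Y hY using (hsum Y (subset_closure hY)).symm
    rw [hev.fderiv_eq, fderiv_fun_sum fun i _ => ((hfc i).differentiable one_ne_zero) X]
    simp
  have rhs : ∫ P, w P * u P ∂σ = ∫ P, ∑ i, w P * (f i P * u P) ∂σ := by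
    refine integral_congr_ae ?_
    filter_upwards [hσ] with P hP
    rw [← Finset.mul_sum, hsum P hP]
  rw [lhs, rhs, integral_finsetSum, integral_finsetSum]
  · exact Finset.sum_congr rfl fun i _ => hi i
  · intro i _
    exact ((hfc i).continuous.integrable_of_hasCompactSupport (hcs i)).bdd_mul hwm
      (Filter.Eventually.of_forall hw)
  · intro i _
    refine Integrable.integrableOn (Continuous.integrable_of_hasCompactSupport ?_ ?_)
    · exact ((hfc i).continuous_fderiv one_ne_zero).clm_apply continuous_const
    · exact ((hcs i).fderiv ℝ).comp_left (g := fun A : V →L[ℝ] ℝ => A e) rfl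

theorem integral_fderiv_eq_zero {V : Type*} [NormedAddCommGroup V] [InnerProductSpace ℝ V]
    [FiniteDimensional ℝ V] [MeasurableSpace V] [BorelSpace V] {u : V → ℝ} (hu : ContDiff ℝ 1 u)
    (hc : HasCompactSupport u) (e : V) : ∫ X, fderiv ℝ u X e = 0 := by
  obtain ⟨C, hC⟩ := hu.lipschitzWith_of_hasCompactSupport hc one_ne_zero
  rw [← integral_lineDeriv_eq_zero hC hc e]
  refine integral_congr_ae (Filter.Eventually.of_forall fun X => ?_)
  exact ((hu.differentiable one_ne_zero) X).lineDeriv_eq_fderiv.symm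

namespace IsBoundedLipschitzDomain

variable {n : ℕ} {D : Set (EuclideanSpace ℝ (Fin (n + 1)))}

theorem isCompact_frontier (hD : IsBoundedLipschitzDomain n D) : IsCompact (frontier D) :=
  hD.isBounded.isCompact_closure.of_isClosed_subset isClosed_frontier frontier_subset_closure

theorem exists_finite_graphChart_cover (hD : IsBoundedLipschitzDomain n D) :
    ∃ (t : Finset (EuclideanSpace ℝ (Fin (n + 1)))) (r : EuclideanSpace ℝ (Fin (n + 1)) → ℝ),
      (∀ P ∈ t, ∃ ι φ L, IsGraphChart D (Metric.ball P (r P)) ι φ L) ∧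
      frontier D ⊆ ⋃ P ∈ t, Metric.ball P (r P) := by
  choose! r hr0 hr using fun P hP => hD.exists_isGraphChart (P := P) hP
  obtain ⟨t, htD, htc⟩ := hD.isCompact_frontier.elim_nhds_subcover (fun X => Metric.ball X (r X))
    fun X hX => Metric.ball_mem_nhds X (hr0 X hX)
  exact ⟨t, r, fun P hP => hr P (htD P hP), htc⟩

theorem aestronglyMeasurable_outerNormal (hD : IsBoundedLipschitzDomain n D) :
    AEStronglyMeasurable (outerNormal D) (surfaceMeasure n D) := by
  obtain ⟨t, r, ht, hcov⟩ := hD.exists_finite_graphChart_cover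
  have h1 : AEStronglyMeasurable (outerNormal D)
      ((surfaceMeasure n D).restrict (⋃ P : t, Metric.ball (P : _) (r P))) := by
    refine aestronglyMeasurable_iUnion_iff.2 fun P => ?_
    obtain ⟨ι, φ, L, h⟩ := ht P P.2
    exact h.aestronglyMeasurable_outerNormal
  have h2 : (surfaceMeasure n D).restrict (⋃ P : t, Metric.ball (P : _) (r P))
      = surfaceMeasure n D := by
    rw [iUnion_subtype]
    refine Measure.restrict_eq_self_of_ae_mem ?_
    filter_upwards [ae_restrict_mem isClosed_frontier.measurableSet] with P hP using hcov hP
  rwa [h2] at h1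

/-- The surface measure of a bounded Lipschitz domain is upper Ahlfors regular. -/
theorem surfaceMeasure_closedBall_le (hD : IsBoundedLipschitzDomain n D) :
    ∃ C : ℝ≥0, ∀ (P : EuclideanSpace ℝ (Fin (n + 1))) (r : ℝ), 0 ≤ r →
      surfaceMeasure n D (Metric.closedBall P r) ≤ C * ENNReal.ofReal (r ^ n) := by
  obtain ⟨t, r, ht, hcov⟩ := hD.exists_finite_graphChart_cover
  have : ∀ P ∈ t, ∃ C : ℝ≥0, ∀ (Q : EuclideanSpace ℝ (Fin (n + 1))) (s : ℝ), 0 ≤ s →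
      surfaceMeasure n D (Metric.ball P (r P) ∩ Metric.closedBall Q s)
        ≤ C * ENNReal.ofReal (s ^ n) := fun P hP => by
    obtain ⟨ι, φ, L, h⟩ := ht P hP
    exact h.surfaceMeasure_inter_closedBall_le
  choose! C hC using this
  refine ⟨∑ P ∈ t, C P, fun Q s hs => ?_⟩
  have hae : surfaceMeasure n D (Metric.closedBall Q s)
      ≤ surfaceMeasure n D (⋃ P ∈ t, Metric.ball P (r P) ∩ Metric.closedBall Q s) := by
    refine measure_mono_ae ?_
    filter_upwards [ae_restrict_mem isClosed_frontier.measurableSet] with X hX hXQ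
    obtain ⟨P, hP, hXP⟩ := mem_iUnion₂.1 (hcov hX)
    exact mem_iUnion₂.2 ⟨P, hP, hXP, hXQ⟩
  refine hae.trans ((measure_biUnion_finset_le _ _).trans ?_)
  rw [ENNReal.ofNNReal_finsetSum, Finset.sum_mul]
  exact Finset.sum_le_sum fun P hP => hC P hP Q s hs

theorem isFiniteMeasure_surfaceMeasure (hD : IsBoundedLipschitzDomain n D) :
    IsFiniteMeasure (surfaceMeasure n D) := by
  obtain ⟨C, hC⟩ := hD.surfaceMeasure_closedBall_le
  obtain ⟨R, hR0, hR⟩ := hD.isCompact_frontier.isBounded.subset_closedBall_lt 0 0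
  refine ⟨lt_of_le_of_lt ?_ (lt_of_le_of_lt (hC 0 R hR0.le)
    (ENNReal.mul_lt_top ENNReal.coe_lt_top ENNReal.ofReal_lt_top))⟩
  refine measure_mono_ae ?_
  filter_upwards [ae_restrict_mem isClosed_frontier.measurableSet] with X hX _ using hR hX

/-- The **divergence theorem** for `C¹` functions on a bounded Lipschitz domain. -/
theorem setIntegral_fderiv (hD : IsBoundedLipschitzDomain n D)
    {u : EuclideanSpace ℝ (Fin (n + 1)) → ℝ} (hu : ContDiff ℝ 1 u)
    (e : EuclideanSpace ℝ (Fin (n + 1))) :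
    ∫ X in D, fderiv ℝ u X e = ∫ P, inner ℝ (outerNormal D P) e * u P ∂surfaceMeasure n D := by
  have := hD.isFiniteMeasure_surfaceMeasure
  refine setIntegral_fderiv_of_local (c := ‖e‖) hD.isOpen hD.isBounded ?_ ?_ (fun P => ?_) e
    (fun X hX => ?_) hu
  · filter_upwards [ae_restrict_mem isClosed_frontier.measurableSet] with P hP
      using frontier_subset_closure hP
  · exact hD.aestronglyMeasurable_outerNormal.inner aestronglyMeasurable_const
  · exact (norm_inner_le_norm _ _).trans
      (mul_le_of_le_one_left (norm_nonneg _) (norm_outerNormal_le D P))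
  · by_cases hXf : X ∈ frontier D
    · obtain ⟨r, hr, ι, φ, L, h⟩ := hD.exists_isGraphChart hXf
      exact ⟨r, hr, fun u hu hc hs => h.setIntegral_fderiv hu hc hs hD.isOpen.measurableSet e⟩
    -- Near an interior point both sides vanish: u is compactly supported inside D and is 0 on the
    -- boundary.
    · have hXD : X ∈ D := by
        by_contra hn
        exact hXf ⟨hX, fun h' => hn (interior_subset h')⟩
      obtain ⟨r, hr, hball⟩ := Metric.isOpen_iff.1 hD.isOpen X hXD
      refine ⟨r, hr, fun u hu hc hs => ?_⟩
      have hz : ∀ Y, Y ∉ D → fderiv ℝ u Y e = 0 := fun Y hY => by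
        rw [image_eq_zero_of_notMem_tsupport (f := fderiv ℝ u) fun h' =>
          hY (hball (hs (tsupport_fderiv_subset ℝ h')))]
        rfl
      rw [setIntegral_eq_integral_of_forall_compl_eq_zero hz, integral_fderiv_eq_zero hu hc]
      symm
      refine integral_eq_zero_of_ae ?_
      filter_upwards [ae_restrict_mem isClosed_frontier.measurableSet] with P hP
      have hPD : P ∉ D := fun h' => hP.2 (hD.isOpen.interior_eq.symm ▸ h')
      rw [image_eq_zero_of_notMem_tsupport (f := u) fun h' => hPD (hball (hs h')), mul_zero]
      rfl

end IsBoundedLipschitzDomain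

end LipschitzDomain

/-! ### Riesz potentials and the Schur test -/

section KernelOperators

open Set

/-- The Riesz potential of order one of an upper Ahlfors `(k+1)`-regular measure is bounded on
bounded sets. -/
theorem exists_lintegral_inv_dist_pow_le {X : Type*} [MetricSpace X] [MeasurableSpace X]
    [OpensMeasurableSpace X] {μ : Measure X} {k : ℕ} {C : ℝ≥0}
    (hμ : ∀ (P : X) (r : ℝ), 0 ≤ r →
      μ (Metric.closedBall P r) ≤ C * ENNReal.ofReal (r ^ (k + 1))) {R : ℝ} (hR : 0 ≤ R) :
    ∃ M : ℝ≥0, ∀ P : X,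
      ∫⁻ Q in Metric.closedBall P R, ENNReal.ofReal ((dist Q P ^ k)⁻¹) ∂μ ≤ M := by
  set S : ℝ≥0∞ := ∑' j : ℕ, ENNReal.ofReal (1 / 2) ^ j with hS
  have hSfin : S ≠ ∞ := by
    rw [hS, ENNReal.tsum_geometric]
    refine ENNReal.inv_ne_top.2 (tsub_pos_of_lt ?_).ne'
    rw [ENNReal.ofReal_lt_one]; norm_num
  refine ⟨(C * ENNReal.ofReal (R * 2 ^ k) * S).toNNReal, fun P => ?_⟩
  rw [ENNReal.coe_toNNReal (ENNReal.mul_ne_top (ENNReal.mul_ne_top ENNReal.coe_ne_top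
    ENNReal.ofReal_ne_top) hSfin)]
  -- Dyadic shells: on A j the integrand is at most (R 2^{-(j+1)})^{-k} and the measure at most C (R
  -- 2^{-j})^{k+1}, with product C R 2^k 2^{-j}, a geometric series.
  set A : ℕ → Set X := fun j =>
    {Q | R * (1 / 2) ^ (j + 1) < dist Q P ∧ dist Q P ≤ R * (1 / 2) ^ j} with hA
  have hcov : Metric.closedBall P R ⊆ {P} ∪ ⋃ j, A j := by
    intro Q hQ
    rw [Metric.mem_closedBall] at hQ
    rcases eq_or_ne Q P with h | h
    · exact Or.inl h
    · refine Or.inr ?_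
      have hd : 0 < dist Q P := dist_pos.2 h
      have hR' : 0 < R := hd.trans_le hQ
      obtain ⟨j, hj1, hj2⟩ := exists_nat_pow_near_of_lt_one (x := dist Q P / R) (y := 1 / 2)
        (by positivity) (by rw [div_le_one hR']; exact hQ) (by norm_num) (by norm_num)
      refine mem_iUnion.2 ⟨j, ?_, ?_⟩
      · rwa [lt_div_iff₀' hR'] at hj1
      · rwa [div_le_iff₀' hR'] at hj2
  -- The shells miss P; radius 0 in `hμ` shows it is not an atom, as k + 1 > 0.
  have hP0 : μ {P} = 0 := by
    have := hμ P 0 le_rfl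
    simpa using this
  calc ∫⁻ Q in Metric.closedBall P R, ENNReal.ofReal ((dist Q P ^ k)⁻¹) ∂μ
      ≤ ∫⁻ Q in {P} ∪ ⋃ j, A j, ENNReal.ofReal ((dist Q P ^ k)⁻¹) ∂μ :=
        lintegral_mono_set hcov
    _ ≤ ∫⁻ Q in {P}, ENNReal.ofReal ((dist Q P ^ k)⁻¹) ∂μ
        + ∫⁻ Q in ⋃ j, A j, ENNReal.ofReal ((dist Q P ^ k)⁻¹) ∂μ := lintegral_union_le _ _ _
    _ = ∫⁻ Q in ⋃ j, A j, ENNReal.ofReal ((dist Q P ^ k)⁻¹) ∂μ := by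
        rw [setLIntegral_measure_zero _ _ hP0, zero_add]
    _ ≤ ∑' j, ∫⁻ Q in A j, ENNReal.ofReal ((dist Q P ^ k)⁻¹) ∂μ := lintegral_iUnion_le _ _
    _ ≤ ∑' j, C * ENNReal.ofReal (R * 2 ^ k) * ENNReal.ofReal (1 / 2) ^ j := by
        refine ENNReal.tsum_le_tsum fun j => ?_
        rcases hR.eq_or_lt with rfl | hR'
        · have : A j = ∅ := by
            ext Q; simp only [hA, mem_ofPred_eq, zero_mul, mem_empty_iff_false, iff_false]
            exact fun h => absurd (h.1.trans_le h.2) (lt_irrefl _)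
          simp [this]
        have hm : μ (A j) ≤ C * ENNReal.ofReal ((R * (1 / 2) ^ j) ^ (k + 1)) :=
          (measure_mono fun Q hQ => Metric.mem_closedBall.2 hQ.2).trans
            (hμ P _ (by positivity))
        calc ∫⁻ Q in A j, ENNReal.ofReal ((dist Q P ^ k)⁻¹) ∂μ
            ≤ ∫⁻ _ in A j, ENNReal.ofReal (((R * (1 / 2) ^ (j + 1)) ^ k)⁻¹) ∂μ := by
              refine setLIntegral_mono measurable_const fun Q hQ => ?_
              refine ENNReal.ofReal_le_ofReal (inv_anti₀ (by positivity) ?_)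
              exact pow_le_pow_left₀ (by positivity) hQ.1.le k
          _ = ENNReal.ofReal (((R * (1 / 2) ^ (j + 1)) ^ k)⁻¹) * μ (A j) := setLIntegral_const _ _
          _ ≤ ENNReal.ofReal (((R * (1 / 2) ^ (j + 1)) ^ k)⁻¹) *
              (C * ENNReal.ofReal ((R * (1 / 2) ^ j) ^ (k + 1))) := by gcongr
          _ = C * ENNReal.ofReal (R * 2 ^ k) * ENNReal.ofReal (1 / 2) ^ j := by
              rw [mul_left_comm, mul_assoc, ← ENNReal.ofReal_mul (by positivity),
                ← ENNReal.ofReal_pow (by positivity), ← ENNReal.ofReal_mul (by positivity)]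
              congr 2
              have e1 : (R * (1 / 2) ^ j) ^ (k + 1)
                  = (R * (1 / 2) ^ (j + 1)) ^ k * (2 ^ k * (R * (1 / 2) ^ j)) := by
                have e2 : R * (1 / 2) ^ (j + 1) = R * (1 / 2) ^ j * (1 / 2) := by ring
                have e3 : (1 / 2 : ℝ) ^ k * 2 ^ k = 1 := by rw [← mul_pow]; norm_num
                rw [e2, mul_pow _ (1 / 2 : ℝ) k, pow_succ]
                linear_combination -((R * (1 / 2) ^ j) ^ k * (R * (1 / 2) ^ j)) * e3
              rw [e1, inv_mul_cancel_left₀ (by positivity)]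
              ring
    _ = C * ENNReal.ofReal (R * 2 ^ k) * S := ENNReal.tsum_mul_left

variable {X : Type*} [MeasurableSpace X] {σ : Measure X} [IsFiniteMeasure σ] {k : X → X → ℝ}
  {M : ℝ≥0}

/-- Tonelli, then the column bound. Used with g = |f| for absolute convergence and with g = |f|^q in
the Schur test. -/
theorem lintegral_lintegral_kernel_mul_le
    (hk : AEStronglyMeasurable (Function.uncurry k) (σ.prod σ))
    (hcol : ∀ᵐ Q ∂σ, ∫⁻ P, ‖k P Q‖ₑ ∂σ ≤ M) {g : X → ℝ≥0∞} (hg : AEMeasurable g σ) :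
    ∫⁻ P, ∫⁻ Q, ‖k P Q‖ₑ * g Q ∂σ ∂σ ≤ M * ∫⁻ Q, g Q ∂σ := by
  have hm : AEMeasurable (Function.uncurry fun P Q => ‖k P Q‖ₑ * g Q) (σ.prod σ) :=
    hk.enorm.mul (hg.comp_quasiMeasurePreserving Measure.quasiMeasurePreserving_snd)
  rw [lintegral_lintegral_swap hm, ← lintegral_const_mul'' _ hg]
  refine lintegral_mono_ae ?_
  have hs : ∀ᵐ Q ∂σ, AEStronglyMeasurable (fun P => k P Q) σ := hk.prod_swap.prodMk_left
  filter_upwards [hcol, hs] with Q hQ hsQ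
  rw [lintegral_mul_const'' _ hsQ.enorm]
  gcongr

theorem integrable_kernel_mul (hk : AEStronglyMeasurable (Function.uncurry k) (σ.prod σ))
    (hcol : ∀ᵐ Q ∂σ, ∫⁻ P, ‖k P Q‖ₑ ∂σ ≤ M) {f : X → ℝ} (hf : Integrable f σ) :
    Integrable (Function.uncurry fun P Q => k P Q * f Q) (σ.prod σ) := by
  have hm : AEStronglyMeasurable (Function.uncurry fun P Q => k P Q * f Q) (σ.prod σ) :=
    hk.mul hf.1.comp_snd
  refine ⟨hm, ?_⟩
  rw [HasFiniteIntegral, lintegral_prod _ hm.enorm]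
  refine lt_of_le_of_lt (le_of_eq_of_le ?_ (lintegral_lintegral_kernel_mul_le hk hcol hf.1.enorm))
    (ENNReal.mul_lt_top ENNReal.coe_lt_top hf.2)
  simp [Function.uncurry]

/-- The **Schur test**. -/
theorem eLpNorm_kernel_le (hk : AEStronglyMeasurable (Function.uncurry k) (σ.prod σ))
    (hrow : ∀ᵐ P ∂σ, ∫⁻ Q, ‖k P Q‖ₑ ∂σ ≤ M) (hcol : ∀ᵐ Q ∂σ, ∫⁻ P, ‖k P Q‖ₑ ∂σ ≤ M)
    {p : ℝ≥0∞} (hp : 1 ≤ p) {f : X → ℝ} (hf : AEStronglyMeasurable f σ) :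
    eLpNorm (fun P => ∫ Q, k P Q * f Q ∂σ) p σ ≤ M * eLpNorm f p σ := by
  have hT : ∀ P, ‖∫ Q, k P Q * f Q ∂σ‖ₑ ≤ ∫⁻ Q, ‖k P Q‖ₑ * ‖f Q‖ₑ ∂σ := fun P =>
    (enorm_integral_le_lintegral_enorm _).trans (le_of_eq (by simp))
  have hs : ∀ᵐ P ∂σ, AEStronglyMeasurable (fun Q => k P Q) σ := hk.prodMk_left
  rcases eq_or_ne p ∞ with rfl | hptop
  · rw [eLpNorm_exponent_top, eLpNorm_exponent_top]
    refine eLpNormEssSup_le_of_ae_enorm_bound ?_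
    filter_upwards [hrow, hs] with P hP hsP
    refine (hT P).trans ?_
    calc ∫⁻ Q, ‖k P Q‖ₑ * ‖f Q‖ₑ ∂σ ≤ ∫⁻ Q, ‖k P Q‖ₑ * eLpNormEssSup f σ ∂σ := by
          refine lintegral_mono_ae ?_
          filter_upwards [enorm_ae_le_eLpNormEssSup f σ] with Q hQ
          gcongr
      _ = (∫⁻ Q, ‖k P Q‖ₑ ∂σ) * eLpNormEssSup f σ := lintegral_mul_const'' _ hsP.enorm
      _ ≤ M * eLpNormEssSup f σ := by gcongr
  have hp0 : p ≠ 0 := (zero_lt_one.trans_le hp).ne'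
  set q := p.toReal with hq
  have hq1 : 1 ≤ q := by
    rw [hq, ← ENNReal.toReal_one]
    exact ENNReal.toReal_mono hptop hp
  have hq0 : 0 < q := by linarith
  -- Hölder's inequality for the measure |k(P, ·)| σ, whose mass is at most M by the row bound.
  have hpt : ∀ᵐ P ∂σ, (∫⁻ Q, ‖k P Q‖ₑ * ‖f Q‖ₑ ∂σ) ^ q
      ≤ (M : ℝ≥0∞) ^ (q - 1) * ∫⁻ Q, ‖k P Q‖ₑ * ‖f Q‖ₑ ^ q ∂σ := by
    filter_upwards [hrow, hs] with P hP hsP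
    set ν := σ.withDensity fun Q => ‖k P Q‖ₑ with hν
    have hfν : AEStronglyMeasurable f ν := hf.mono_ac (withDensity_absolutelyContinuous _ _)
    have h1 := eLpNorm'_le_eLpNorm'_mul_rpow_measure_univ one_pos hq1 hfν
    have hνu : ν univ ≤ M := by
      rw [hν, withDensity_apply _ MeasurableSet.univ, Measure.restrict_univ]; exact hP
    have e1 : eLpNorm' f 1 ν = ∫⁻ Q, ‖k P Q‖ₑ * ‖f Q‖ₑ ∂σ := by
      rw [eLpNorm'_eq_lintegral_enorm]
      simp only [ENNReal.rpow_one, div_one]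
      rw [hν, lintegral_withDensity_eq_lintegral_mul₀ hsP.enorm hf.enorm]
      rfl
    have e2 : eLpNorm' f q ν ^ q = ∫⁻ Q, ‖k P Q‖ₑ * ‖f Q‖ₑ ^ q ∂σ := by
      rw [eLpNorm'_eq_lintegral_enorm, ← ENNReal.rpow_mul, one_div_mul_cancel hq0.ne',
        ENNReal.rpow_one, hν,
        lintegral_withDensity_eq_lintegral_mul₀ hsP.enorm (hf.enorm.pow_const q)]
      rfl
    rw [← e1, ← e2]
    calc eLpNorm' f 1 ν ^ q
        ≤ (eLpNorm' f q ν * ν univ ^ (1 / 1 - 1 / q)) ^ q :=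
          ENNReal.rpow_le_rpow h1 hq0.le
      _ = eLpNorm' f q ν ^ q * ν univ ^ (q - 1) := by
          rw [ENNReal.mul_rpow_of_nonneg _ _ hq0.le, ← ENNReal.rpow_mul]
          congr 2
          field_simp
      _ ≤ eLpNorm' f q ν ^ q * (M : ℝ≥0∞) ^ (q - 1) := by
          gcongr
      _ = _ := mul_comm _ _
  rw [eLpNorm_eq_lintegral_rpow_enorm_toReal hp0 hptop,
    eLpNorm_eq_lintegral_rpow_enorm_toReal hp0 hptop, ← hq]
  have hmain : ∫⁻ P, ‖∫ Q, k P Q * f Q ∂σ‖ₑ ^ q ∂σ ≤ (M : ℝ≥0∞) ^ q * ∫⁻ Q, ‖f Q‖ₑ ^ q ∂σ :=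
    calc ∫⁻ P, ‖∫ Q, k P Q * f Q ∂σ‖ₑ ^ q ∂σ
        ≤ ∫⁻ P, (M : ℝ≥0∞) ^ (q - 1) * ∫⁻ Q, ‖k P Q‖ₑ * ‖f Q‖ₑ ^ q ∂σ ∂σ := by
          refine lintegral_mono_ae ?_
          filter_upwards [hpt] with P hP
          exact (ENNReal.rpow_le_rpow (hT P) hq0.le).trans hP
      _ = (M : ℝ≥0∞) ^ (q - 1) * ∫⁻ P, ∫⁻ Q, ‖k P Q‖ₑ * ‖f Q‖ₑ ^ q ∂σ ∂σ :=
          lintegral_const_mul' _ _ (ENNReal.rpow_ne_top_of_nonneg (by linarith) ENNReal.coe_ne_top)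
      _ ≤ (M : ℝ≥0∞) ^ (q - 1) * (M * ∫⁻ Q, ‖f Q‖ₑ ^ q ∂σ) := by
          gcongr
          exact lintegral_lintegral_kernel_mul_le hk hcol (hf.enorm.pow_const q)
      _ = (M : ℝ≥0∞) ^ q * ∫⁻ Q, ‖f Q‖ₑ ^ q ∂σ := by
          rw [← mul_assoc]
          congr 1
          conv_lhs => rw [← ENNReal.rpow_one (M : ℝ≥0∞), ENNReal.rpow_one (M : ℝ≥0∞)]
          rw [← ENNReal.coe_rpow_of_nonneg _ (by linarith),
            ← ENNReal.coe_rpow_of_nonneg _ hq0.le, ← ENNReal.coe_mul]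
          congr 1
          rw [← NNReal.rpow_add_one' (by linarith)]
          congr 1; ring
  calc (∫⁻ P, ‖∫ Q, k P Q * f Q ∂σ‖ₑ ^ q ∂σ) ^ (1 / q)
      ≤ ((M : ℝ≥0∞) ^ q * ∫⁻ Q, ‖f Q‖ₑ ^ q ∂σ) ^ (1 / q) :=
        ENNReal.rpow_le_rpow hmain (by positivity)
    _ = M * (∫⁻ Q, ‖f Q‖ₑ ^ q ∂σ) ^ (1 / q) := by
        rw [ENNReal.mul_rpow_of_nonneg _ _ (by positivity), ← ENNReal.rpow_mul,
          mul_one_div_cancel hq0.ne', ENNReal.rpow_one]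

end KernelOperators

/-! ### Radial profiles and the regularized divergence identity -/

section RadialFields

open Module Set

/-- The radial profiles `s ↦ s^b (l log s + κ)`. -/
noncomputable def radialProfile (b l κ s : ℝ) : ℝ := s ^ b * (l * Real.log s + κ)

theorem hasDerivAt_radialProfile (b l κ : ℝ) {s : ℝ} (hs : 0 < s) :
    HasDerivAt (radialProfile b l κ) (radialProfile (b - 1) (b * l) (b * κ + l) s) s := by
  have h1 : HasDerivAt (fun s : ℝ => s ^ b) (b * s ^ (b - 1)) s :=
    Real.hasDerivAt_rpow_const (Or.inl hs.ne')
  have h2 : HasDerivAt (fun s : ℝ => l * Real.log s + κ) (l * s⁻¹) s :=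
    ((Real.hasDerivAt_log hs.ne').const_mul l).add_const κ
  refine (h1.mul h2).congr_deriv ?_
  have : s ^ b = s ^ (b - 1) * s := by
    rw [← Real.rpow_add_one hs.ne', sub_add_cancel]
  rw [radialProfile, this]
  field_simp
  ring

theorem mul_radialProfile_sub_one (b l κ : ℝ) {s : ℝ} (hs : 0 < s) :
    s * radialProfile (b - 1) l κ s = radialProfile b l κ s := by
  have : s ^ b = s ^ (b - 1) * s := by
    rw [← Real.rpow_add_one hs.ne', sub_add_cancel]
  rw [radialProfile, radialProfile, this]; ring

theorem continuousAt_radialProfile (b l κ : ℝ) {s : ℝ} (hs : 0 < s) :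
    ContinuousAt (radialProfile b l κ) s := (hasDerivAt_radialProfile b l κ hs).continuousAt

theorem measurable_radialProfile (b l κ : ℝ) : Measurable (radialProfile b l κ) := by
  unfold radialProfile; fun_prop

theorem contDiff_radialProfile_comp {V : Type*} [NormedAddCommGroup V] [NormedSpace ℝ V]
    (b l κ : ℝ) {g : V → ℝ} (hg : ContDiff ℝ 1 g) (h0 : ∀ X, 0 < g X) :
    ContDiff ℝ 1 fun X => radialProfile b l κ (g X) := by
  unfold radialProfile
  exact (hg.rpow_const_of_ne fun X => (h0 X).ne').mul
    ((contDiff_const.mul (hg.log fun X => (h0 X).ne')).add contDiff_const)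

/-- The spare power c = b - a absorbs the logarithm: after rescaling to y = s/S ≤ 1, |y^c log y| ≤
1/c. -/
theorem exists_abs_radialProfile_le {a b : ℝ} (hab : a < b) (l κ S : ℝ) (hS : 0 < S) :
    ∃ A : ℝ, 0 ≤ A ∧ ∀ s, 0 < s → s ≤ S → |radialProfile b l κ s| ≤ A * s ^ a := by
  set c := b - a with hc
  have hc0 : 0 < c := sub_pos.2 hab
  refine ⟨S ^ c * (|l| * (1 / c) + |l * Real.log S + κ|), by positivity, fun s hs hsS => ?_⟩
  set y := s / S with hy
  have hy0 : 0 < y := by positivity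
  have hy1 : y ≤ 1 := (div_le_one hS).2 hsS
  have hsy : s = S * y := by rw [hy]; field_simp
  have hlog := (Real.abs_log_mul_self_rpow_lt y c hy0 hy1 hc0).le
  have hyc : y ^ c ≤ 1 := Real.rpow_le_one hy0.le hy1 hc0.le
  have hsb : s ^ b = s ^ a * (S ^ c * y ^ c) := by
    rw [← Real.mul_rpow hS.le hy0.le, ← hsy, ← Real.rpow_add hs, hc]; congr 1; ring
  have hls : Real.log s = Real.log S + Real.log y := by
    rw [hsy, Real.log_mul hS.ne' hy0.ne']
  have e : radialProfile b l κ s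
      = s ^ a * (S ^ c * (l * (Real.log y * y ^ c) + y ^ c * (l * Real.log S + κ))) := by
    rw [radialProfile, hsb, hls]; ring
  have hsa : 0 ≤ s ^ a := by positivity
  have hSc : 0 ≤ S ^ c := by positivity
  have hyc0 : 0 ≤ y ^ c := by positivity
  rw [e, abs_mul, abs_of_nonneg hsa, abs_mul, abs_of_nonneg hSc, mul_comm]
  refine mul_le_mul_of_nonneg_right (mul_le_mul_of_nonneg_left ?_ hSc) hsa
  refine (abs_add_le _ _).trans (add_le_add ?_ ?_)
  · rw [abs_mul]; gcongr
  · rw [abs_mul, abs_of_nonneg hyc0]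
    exact mul_le_of_le_one_left (abs_nonneg _) hyc

/-- Uniformity in ε comes from the exponent -n/2 ≤ 0: dropping ε² only enlarges the bound. It serves
as the dominating function as ε → 0, and at ε = 0 it bounds the kernels themselves. -/
theorem exists_abs_radialProfile_norm_sq_le {n : ℕ} {b : ℝ} (hb : -(n : ℝ) / 2 < b)
    (l κ R : ℝ) :
    ∃ A : ℝ, 0 ≤ A ∧ ∀ r ε : ℝ, 0 < r → r ≤ R → 0 ≤ ε → ε ≤ 1 →
      |radialProfile b l κ (r ^ 2 + ε ^ 2)| ≤ A * (r ^ n)⁻¹ := by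
  obtain ⟨A, hA0, hA⟩ := exists_abs_radialProfile_le hb l κ (R ^ 2 + 1) (by positivity)
  refine ⟨A, hA0, fun r ε hr hrR hε hε1 => ?_⟩
  have hpos : 0 < r ^ 2 + ε ^ 2 := by positivity
  refine (hA _ hpos ?_).trans ?_
  · gcongr
    exact pow_le_one₀ hε hε1
  · gcongr
    calc (r ^ 2 + ε ^ 2) ^ (-(n : ℝ) / 2) ≤ (r ^ 2) ^ (-(n : ℝ) / 2) := by
          refine Real.rpow_le_rpow_of_nonpos (by positivity) (by nlinarith [sq_nonneg ε]) ?_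
          have : (0 : ℝ) ≤ n := by positivity
          linarith
      _ = (r ^ n)⁻¹ := by
          rw [← Real.rpow_natCast r 2, ← Real.rpow_mul hr.le, ← Real.rpow_natCast r n,
            ← Real.rpow_neg hr.le]
          congr 1
          push_cast; ring

namespace IsBoundedLipschitzDomain

variable {n : ℕ} {D : Set (EuclideanSpace ℝ (Fin (n + 1)))}

theorem integrable_outerNormal_mul_continuous (hD : IsBoundedLipschitzDomain n D)
    {g : EuclideanSpace ℝ (Fin (n + 1)) → ℝ} (hg : Continuous g)
    (e : EuclideanSpace ℝ (Fin (n + 1))) :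
    Integrable (fun P => inner ℝ (outerNormal D P) e * g P) (surfaceMeasure n D) := by
  have := hD.isFiniteMeasure_surfaceMeasure
  obtain ⟨C, hC⟩ := hD.isCompact_frontier.exists_bound_of_continuousOn hg.continuousOn
  refine Integrable.of_bound ((hD.aestronglyMeasurable_outerNormal.inner
    aestronglyMeasurable_const).mul hg.aestronglyMeasurable) (‖e‖ * C) ?_
  filter_upwards [ae_restrict_mem isClosed_frontier.measurableSet] with P hP
  rw [norm_mul]
  refine mul_le_mul ?_ (hC P hP) (norm_nonneg _) (norm_nonneg _)
  exact (norm_inner_le_norm _ _).trans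
      (mul_le_of_le_one_left (norm_nonneg _) (norm_outerNormal_le D P))

/-- The divergence theorem for the regularized radial fields. -/
theorem setIntegral_div_radialProfile (hD : IsBoundedLipschitzDomain n D) (b l κ : ℝ) {ε : ℝ}
    (hε : 0 < ε) (Q : EuclideanSpace ℝ (Fin (n + 1))) :
    ∫ X in D, (2 * radialProfile (b - 1) (b * l) (b * κ + l) (‖X - Q‖ ^ 2 + ε ^ 2) * ‖X - Q‖ ^ 2
        + (n + 1) * radialProfile b l κ (‖X - Q‖ ^ 2 + ε ^ 2))
      = ∫ P, radialProfile b l κ (‖P - Q‖ ^ 2 + ε ^ 2) * inner ℝ (outerNormal D P) (P - Q)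
          ∂surfaceMeasure n D := by
  set B := EuclideanSpace.basisFun (Fin (n + 1)) ℝ
  set g : EuclideanSpace ℝ (Fin (n + 1)) → ℝ := fun X => ‖X - Q‖ ^ 2 + ε ^ 2 with hg
  have hg0 : ∀ X, 0 < g X := fun X => by positivity
  have hgc : ContDiff ℝ 1 g := ((contDiff_id.sub contDiff_const).norm_sq ℝ).add contDiff_const
  have hρ := contDiff_radialProfile_comp b l κ hgc hg0
  -- The coordinates of the field ρ(|X - Q|² + ε²)(X - Q); the scalar divergence theorem for u i in
  -- direction B i is summed over i.
  set u : Fin (n + 1) → EuclideanSpace ℝ (Fin (n + 1)) → ℝ :=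
    fun i X => radialProfile b l κ (g X) * inner ℝ (X - Q) (B i) with hu
  have huc : ∀ i, ContDiff ℝ 1 (u i) := fun i =>
    hρ.mul ((contDiff_id.sub contDiff_const).inner ℝ contDiff_const)
  have hdu : ∀ i X, fderiv ℝ (u i) X (B i)
      = 2 * radialProfile (b - 1) (b * l) (b * κ + l) (g X) * inner ℝ (X - Q) (B i) ^ 2
        + radialProfile b l κ (g X) := by
    intro i X
    have h1 : HasFDerivAt g (2 • (innerSL ℝ (X - Q)).comp
        (ContinuousLinearMap.id ℝ (EuclideanSpace ℝ (Fin (n + 1))))) X :=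
      (((hasFDerivAt_id X).sub_const Q).norm_sq).add_const _
    have h2 := (hasDerivAt_radialProfile b l κ (hg0 X)).comp_hasFDerivAt X h1
    have h3 : HasFDerivAt (fun X => inner ℝ (X - Q) (B i)) _ X :=
      ((hasFDerivAt_id X).sub_const Q).inner ℝ (hasFDerivAt_const (B i) X)
    have h4 := (h2.mul h3).fderiv
    change fderiv ℝ (u i) X = _ at h4
    rw [h4]
    simp only [FunLike.coe_add, FunLike.coe_smul, Pi.add_apply, Pi.smul_apply,
      ContinuousLinearMap.comp_apply, ContinuousLinearMap.prod_apply, fderivInnerCLM_apply,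
      Function.comp_apply]
    simp
    rw [inner_sub_left]
    ring
  have h := fun i => hD.setIntegral_fderiv (huc i) (B i)
  have lhs : ∫ X in D, (2 * radialProfile (b - 1) (b * l) (b * κ + l) (g X) * ‖X - Q‖ ^ 2
        + (n + 1) * radialProfile b l κ (g X)) = ∑ i, ∫ X in D, fderiv ℝ (u i) X (B i) := by
    rw [← integral_finsetSum]
    · refine integral_congr_ae (Filter.Eventually.of_forall fun X => ?_)
      simp only [hdu]
      rw [Finset.sum_add_distrib, ← Finset.mul_sum, ← B.sum_sq_norm_inner_left (X - Q)]
      simp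
    · intro i _
      have hc : Continuous fun X => fderiv ℝ (u i) X (B i) :=
        ((huc i).continuous_fderiv one_ne_zero).clm_apply continuous_const
      exact (hc.continuousOn.integrableOn_compact hD.isBounded.isCompact_closure).mono_set
        subset_closure
  have rhs : ∫ P, radialProfile b l κ (g P) * inner ℝ (outerNormal D P) (P - Q)
          ∂surfaceMeasure n D
      = ∑ i, ∫ P, inner ℝ (outerNormal D P) (B i) * u i P ∂surfaceMeasure n D := by
    rw [← integral_finsetSum]
    · refine integral_congr_ae (Filter.Eventually.of_forall fun P => ?_)
      simp only [hu]
      rw [← B.sum_inner_mul_inner, Finset.mul_sum]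
      refine Finset.sum_congr rfl fun i _ => ?_
      rw [real_inner_comm (P - Q)]
      ring
    · exact fun i _ => hD.integrable_outerNormal_mul_continuous (huc i).continuous (B i)
  rw [lhs, rhs]
  exact Finset.sum_congr rfl fun i _ => h i

end IsBoundedLipschitzDomain

end RadialFields

/-! ### Removing the regularization -/

section SingularFields

open Module Set

namespace IsBoundedLipschitzDomain

variable {n : ℕ} {D : Set (EuclideanSpace ℝ (Fin (n + 1)))}

theorem exists_lintegral_surfaceMeasure_le (hD : IsBoundedLipschitzDomain n D) (hn : 1 ≤ n)
    {R : ℝ} (hR : 0 ≤ R) :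
    ∃ M : ℝ≥0, ∀ P, ∫⁻ Q in Metric.closedBall P R, ENNReal.ofReal ((dist Q P ^ (n - 1))⁻¹)
      ∂surfaceMeasure n D ≤ M := by
  obtain ⟨C, hC⟩ := hD.surfaceMeasure_closedBall_le
  refine exists_lintegral_inv_dist_pow_le (C := C) (fun P r hr => ?_) hR
  rw [Nat.sub_add_cancel hn]
  exact hC P r hr

theorem _root_.exists_lintegral_volume_inv_dist_pow_le (n : ℕ) {R : ℝ} (hR : 0 ≤ R) :
    ∃ M : ℝ≥0, ∀ P : EuclideanSpace ℝ (Fin (n + 1)),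
      ∫⁻ X in Metric.closedBall P R, ENNReal.ofReal ((dist X P ^ n)⁻¹) ≤ M := by
  refine exists_lintegral_inv_dist_pow_le
    (C := (volume (Metric.ball (0 : EuclideanSpace ℝ (Fin (n + 1))) 1)).toNNReal)
    (fun P r hr => ?_) hR
  rw [Measure.addHaar_closedBall _ _ hr, finrank_euclideanSpace_fin,
    ENNReal.coe_toNNReal measure_ball_lt_top.ne, mul_comm]

theorem _root_.tendsto_radialProfile_add_sq (b l κ : ℝ) {r : ℝ} (hr : 0 < r) :
    Filter.Tendsto (fun ε : ℝ => radialProfile b l κ (r ^ 2 + ε ^ 2)) (𝓝[>] 0)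
      (𝓝 (radialProfile b l κ (r ^ 2))) := by
  have h1 : Filter.Tendsto (fun ε : ℝ => r ^ 2 + ε ^ 2) (𝓝[>] 0) (𝓝 (r ^ 2)) := by
    have : Continuous fun ε : ℝ => r ^ 2 + ε ^ 2 := by fun_prop
    have := this.tendsto 0
    simp only [ne_eq, OfNat.ofNat_ne_zero, not_false_eq_true, zero_pow, add_zero] at this
    exact this.mono_left nhdsWithin_le_nhds
  exact (continuousAt_radialProfile b l κ (by positivity : 0 < r ^ 2)).tendsto.comp h1

theorem exists_subset_closedBall (hD : IsBoundedLipschitzDomain n D)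
    (Q : EuclideanSpace ℝ (Fin (n + 1))) :
    ∃ R : ℝ, 0 < R ∧ closure D ⊆ Metric.closedBall Q R := by
  obtain ⟨R, hR0, hR⟩ := hD.isBounded.closure.subset_closedBall_lt 0 Q
  exact ⟨R, hR0, hR⟩

theorem integrableOn_inv_dist_pow (hD : IsBoundedLipschitzDomain n D)
    (Q : EuclideanSpace ℝ (Fin (n + 1))) :
    IntegrableOn (fun X => (dist X Q ^ n)⁻¹) D := by
  obtain ⟨R, hR0, hR⟩ := hD.exists_subset_closedBall Q
  obtain ⟨M, hM⟩ := exists_lintegral_volume_inv_dist_pow_le n hR0.le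
  refine IntegrableOn.mono_set ?_ (subset_closure.trans hR)
  refine ⟨(by fun_prop : Measurable fun X => (dist X Q ^ n)⁻¹).aestronglyMeasurable, ?_⟩
  rw [hasFiniteIntegral_iff_ofReal (Filter.Eventually.of_forall fun X => by positivity)]
  exact (hM Q).trans_lt ENNReal.coe_lt_top

theorem integrable_inv_dist_pow (hD : IsBoundedLipschitzDomain n D) (hn : 1 ≤ n)
    (Q : EuclideanSpace ℝ (Fin (n + 1))) :
    Integrable (fun X => (dist X Q ^ (n - 1))⁻¹) (surfaceMeasure n D) := by
  obtain ⟨R, hR0, hR⟩ := hD.exists_subset_closedBall Q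
  obtain ⟨M, hM⟩ := hD.exists_lintegral_surfaceMeasure_le hn hR0.le
  have h : IntegrableOn (fun X => (dist X Q ^ (n - 1))⁻¹) (Metric.closedBall Q R)
      (surfaceMeasure n D) := by
    refine ⟨(by fun_prop : Measurable fun X => (dist X Q ^ (n - 1))⁻¹).aestronglyMeasurable, ?_⟩
    rw [hasFiniteIntegral_iff_ofReal (Filter.Eventually.of_forall fun X => by positivity)]
    exact (hM Q).trans_lt ENNReal.coe_lt_top
  rwa [IntegrableOn, Measure.restrict_eq_self_of_ae_mem] at h
  filter_upwards [ae_restrict_mem isClosed_frontier.measurableSet] with P hP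
    using hR (frontier_subset_closure hP)

/-- The factor |P - Q| of the surface integrand lowers the singularity to the integrable order n -
1. -/
theorem _root_.inv_pow_mul_self {n : ℕ} (hn : 1 ≤ n) {r : ℝ} (hr : 0 < r) :
    (r ^ n)⁻¹ * r = (r ^ (n - 1))⁻¹ := by
  obtain ⟨k, rfl⟩ : ∃ k, n = k + 1 := ⟨n - 1, by omega⟩
  rw [Nat.add_sub_cancel, pow_succ]
  field_simp

/-- The divergence theorem for weakly singular radial fields. -/
theorem setIntegral_radialProfile (hD : IsBoundedLipschitzDomain n D) (hn : 1 ≤ n) {b : ℝ}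
    (hb : -(n : ℝ) / 2 < b) (l κ : ℝ) (Q : EuclideanSpace ℝ (Fin (n + 1))) :
    ∫ X in D, radialProfile b ((n + 1 + 2 * b) * l) ((n + 1 + 2 * b) * κ + 2 * l) (‖X - Q‖ ^ 2)
      = ∫ P, radialProfile b l κ (‖P - Q‖ ^ 2) * inner ℝ (outerNormal D P) (P - Q)
          ∂surfaceMeasure n D := by
  obtain ⟨R, hR0, hR⟩ := hD.exists_subset_closedBall Q
  obtain ⟨A₁, hA₁0, hA₁⟩ := exists_abs_radialProfile_norm_sq_le hb (b * l) (b * κ + l) R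
  obtain ⟨A₂, hA₂0, hA₂⟩ := exists_abs_radialProfile_norm_sq_le hb l κ R
  have hvolQ : ∀ᵐ X ∂(volume.restrict D), X ≠ Q :=
    ae_restrict_of_ae (measure_eq_zero_iff_ae_notMem.1 (measure_singleton Q))
  have hεn : ∀ᶠ ε : ℝ in 𝓝[>] 0, 0 < ε ∧ ε ≤ 1 := by
    filter_upwards [Ioc_mem_nhdsGT (zero_lt_one' ℝ)] with ε hε using hε
  have hm : ∀ b l κ ε : ℝ, Measurable fun X : EuclideanSpace ℝ (Fin (n + 1)) =>
      radialProfile b l κ (‖X - Q‖ ^ 2 + ε ^ 2) := fun b l κ ε =>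
    (measurable_radialProfile b l κ).comp (by fun_prop)
  have lim₁ : Filter.Tendsto (fun ε : ℝ => ∫ X in D,
      (2 * radialProfile (b - 1) (b * l) (b * κ + l) (‖X - Q‖ ^ 2 + ε ^ 2) * ‖X - Q‖ ^ 2
        + (n + 1) * radialProfile b l κ (‖X - Q‖ ^ 2 + ε ^ 2))) (𝓝[>] 0)
      (𝓝 (∫ X in D, radialProfile b ((n + 1 + 2 * b) * l) ((n + 1 + 2 * b) * κ + 2 * l)
        (‖X - Q‖ ^ 2))) := by
    refine tendsto_integral_filter_of_dominated_convergence
      (fun X => (2 * A₁ + (n + 1) * A₂) * (dist X Q ^ n)⁻¹) ?_ ?_ ?_ ?_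
    · refine Filter.Eventually.of_forall fun ε => Measurable.aestronglyMeasurable ?_
      exact (((hm _ _ _ ε).const_mul 2).mul (by fun_prop)).add ((hm _ _ _ ε).const_mul _)
    · filter_upwards [hεn] with ε hε
      filter_upwards [hvolQ, ae_restrict_mem hD.isOpen.measurableSet] with X hX hXD
      have hr : 0 < ‖X - Q‖ := norm_pos_iff.2 (sub_ne_zero.2 hX)
      have hrR : ‖X - Q‖ ≤ R := by
        rw [← dist_eq_norm]; exact Metric.mem_closedBall.1 (hR (subset_closure hXD))
      have hs : 0 < ‖X - Q‖ ^ 2 + ε ^ 2 := by positivity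
      have h1 := hA₁ _ ε hr hrR hε.1.le hε.2
      have h2 := hA₂ _ ε hr hrR hε.1.le hε.2
      -- The derivative profile has exponent b - 1, too singular for the bound, but it comes
      -- multiplied by |X - Q|² ≤ s with s = |X - Q|² + ε², and s times it has exponent b again.
      rw [← mul_radialProfile_sub_one _ _ _ hs, abs_mul, abs_of_pos hs] at h1
      rw [dist_eq_norm]
      rw [add_mul (2 * A₁)]
      refine (norm_add_le _ _).trans (add_le_add ?_ ?_)
      · rw [Real.norm_eq_abs, abs_mul, abs_mul, abs_two, abs_of_nonneg (sq_nonneg ‖X - Q‖)]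
        have h3 : |radialProfile (b - 1) (b * l) (b * κ + l) (‖X - Q‖ ^ 2 + ε ^ 2)| * ‖X - Q‖ ^ 2
            ≤ (‖X - Q‖ ^ 2 + ε ^ 2) *
              |radialProfile (b - 1) (b * l) (b * κ + l) (‖X - Q‖ ^ 2 + ε ^ 2)| := by
          rw [mul_comm]
          exact mul_le_mul_of_nonneg_right (le_add_of_nonneg_right (sq_nonneg ε)) (abs_nonneg _)
        linarith
      · rw [Real.norm_eq_abs, abs_mul, abs_of_nonneg (by positivity : (0 : ℝ) ≤ (n : ℝ) + 1), mul_assoc]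
        gcongr
    · exact (hD.integrableOn_inv_dist_pow Q).const_mul _
    · filter_upwards [hvolQ] with X hX
      have hr : 0 < ‖X - Q‖ := norm_pos_iff.2 (sub_ne_zero.2 hX)
      have h := (((tendsto_radialProfile_add_sq (b - 1) (b * l) (b * κ + l) hr).const_mul
        2).mul_const (‖X - Q‖ ^ 2)).add
        ((tendsto_radialProfile_add_sq b l κ hr).const_mul ((n : ℝ) + 1))
      convert h using 2
      -- At ε = 0, with s = |X - Q|², the divergence is 2sρ'(s) + (n + 1)ρ(s), again a profile of
      -- exponent b; collecting coefficients gives those in the statement.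
      have h2 := mul_radialProfile_sub_one b (b * l) (b * κ + l) (by positivity : 0 < ‖X - Q‖ ^ 2)
      rw [mul_assoc, mul_comm (radialProfile _ _ _ _) (‖X - Q‖ ^ 2), h2]
      simp only [radialProfile]
      ring
  have lim₂ : Filter.Tendsto (fun ε : ℝ => ∫ P, radialProfile b l κ (‖P - Q‖ ^ 2 + ε ^ 2) *
        inner ℝ (outerNormal D P) (P - Q) ∂surfaceMeasure n D) (𝓝[>] 0)
      (𝓝 (∫ P, radialProfile b l κ (‖P - Q‖ ^ 2) * inner ℝ (outerNormal D P) (P - Q)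
          ∂surfaceMeasure n D)) := by
    refine tendsto_integral_filter_of_dominated_convergence
      (fun P => A₂ * (dist P Q ^ (n - 1))⁻¹) ?_ ?_ ?_ ?_
    · refine Filter.Eventually.of_forall fun ε => (hm _ _ _ ε).aestronglyMeasurable.mul ?_
      exact hD.aestronglyMeasurable_outerNormal.inner
        (by fun_prop : Continuous fun P => P - Q).aestronglyMeasurable
    · filter_upwards [hεn] with ε hε
      filter_upwards [ae_restrict_mem isClosed_frontier.measurableSet] with P hP
      rcases eq_or_ne P Q with rfl | hPQ
      · simp only [sub_self, inner_zero_right, mul_zero, norm_zero]; positivity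
      have hr : 0 < ‖P - Q‖ := norm_pos_iff.2 (sub_ne_zero.2 hPQ)
      have hrR : ‖P - Q‖ ≤ R := by
        rw [← dist_eq_norm]; exact Metric.mem_closedBall.1 (hR (frontier_subset_closure hP))
      rw [dist_eq_norm, ← inv_pow_mul_self hn hr, ← mul_assoc, norm_mul]
      refine mul_le_mul (hA₂ _ ε hr hrR hε.1.le hε.2) ?_ (norm_nonneg _) (by positivity)
      exact (norm_inner_le_norm _ _).trans
        (mul_le_of_le_one_left (norm_nonneg _) (norm_outerNormal_le D P))
    · exact (hD.integrable_inv_dist_pow hn Q).const_mul _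
    · refine Filter.Eventually.of_forall fun P => ?_
      -- Q may lie on the boundary: at P = Q the factor P - Q makes the integrand 0 for every ε.
      rcases eq_or_ne P Q with rfl | hPQ
      · simp
      · exact (tendsto_radialProfile_add_sq b l κ
          (norm_pos_iff.2 (sub_ne_zero.2 hPQ))).mul_const _
  refine tendsto_nhds_unique lim₁ (lim₂.congr' ?_)
  filter_upwards [self_mem_nhdsWithin] with ε hε
  exact (hD.setIntegral_div_radialProfile b l κ hε Q).symm

end IsBoundedLipschitzDomain

end SingularFields

/-! ### The two kernels as radial profiles -/

section Kernels

open Module Set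

theorem sphereArea_pos (n : ℕ) : 0 < sphereArea n := by
  unfold sphereArea
  have : 0 < Real.Gamma (((n : ℝ) + 1) / 2) := Real.Gamma_pos_of_pos (by positivity)
  positivity

/-- γ_k = 2k (2k - n + 1) vanishes for k ≥ 1 only at 2k + 1 = n, which the products in either branch
avoid. -/
theorem gammaCoeff_ne_zero {n k : ℕ} (hk : 1 ≤ k) (h : 2 * k + 1 ≠ n) : gammaCoeff n k ≠ 0 := by
  unfold gammaCoeff deltaCoeff
  refine mul_ne_zero (fun h0 => h ?_) ?_
  · have : ((2 * k + 1 : ℕ) : ℝ) = n := by push_cast; linarith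
    exact_mod_cast this
  · have : (1 : ℝ) ≤ k := by exact_mod_cast hk
    have e : 2 * (k : ℝ) - n + 1 + n - 1 = 2 * k := by ring
    rw [e]; positivity

theorem deltaCoeff_two_mul_ne_zero {n t : ℕ} (hn : 2 ≤ n) (ht : 1 ≤ t) :
    deltaCoeff n (2 * (t : ℝ)) ≠ 0 := by
  unfold deltaCoeff
  have h1 : (1 : ℝ) ≤ t := by exact_mod_cast ht
  have h2 : (2 : ℝ) ≤ n := by exact_mod_cast hn
  have h3 : 0 < 2 * (t : ℝ) + n - 1 := by linarith
  positivity

/-- Reconciles the constants of the logarithmic kernels: the correction 1/(n + 1) in 𝒟_{m-1}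
cancels, leaving 1/(2T + n + 1) = 1/(2m - 2), the term that differentiating the logarithm produces.
-/
theorem sum_one_div_telescope (n T : ℕ) :
    ∑ t ∈ Finset.Icc 1 T, (1 / (2 * (t : ℝ)) + 1 / (2 * (t : ℝ) + n - 1))
      = ∑ t ∈ Finset.Icc 1 T, (1 / (2 * (t : ℝ)) + 1 / (2 * (t : ℝ) + n + 1))
        + 1 / ((n : ℝ) + 1) - 1 / (2 * (T : ℝ) + n + 1) := by
  induction T with
  | zero => simp
  | succ T ih =>
    rw [Finset.sum_Icc_succ_top (by omega), Finset.sum_Icc_succ_top (by omega), ih]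
    have e : 2 * ((T + 1 : ℕ) : ℝ) + n - 1 = 2 * (T : ℝ) + n + 1 := by push_cast; ring
    rw [e]; ring

theorem poissonField_self (n m : ℕ) (x : EuclideanSpace ℝ (Fin (n + 1))) :
    poissonField n m x x = 0 := by
  unfold poissonField; split_ifs <;> simp

theorem zpow_eq_sq_rpow {r : ℝ} (hr : 0 < r) {z : ℤ} {b : ℝ} (h : (z : ℝ) = 2 * b) :
    r ^ z = (r ^ 2) ^ b := by
  rw [← Real.rpow_intCast, h, Real.rpow_mul hr.le, Real.rpow_two]

/-- Both kernels are radial, with profiles related by the divergence. -/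
theorem exists_radialProfile_kernels {n m : ℕ} (hn : 2 ≤ n) (hm : 2 ≤ m) {b : ℝ}
    (hb : 2 * b = 2 * m - n - 3) :
    ∃ e d l κ : ℝ, d ≠ 0 ∧ ∀ x v : EuclideanSpace ℝ (Fin (n + 1)), x ≠ v →
      poissonField n m x v = (e * radialProfile b l κ (‖x - v‖ ^ 2)) • (x - v) ∧
      polyharmonicKernel n (m - 1) x v
        = d * radialProfile b ((n + 1 + 2 * b) * l) ((n + 1 + 2 * b) * κ + 2 * l)
            (‖x - v‖ ^ 2) := by
  have hn2 : (2 : ℝ) ≤ n := by exact_mod_cast hn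
  have hm2 : (2 : ℝ) ≤ m := by exact_mod_cast hm
  have hN : (n : ℝ) + 1 + 2 * b = 2 * m - 2 := by rw [hb]; ring
  have hN0 : (2 * m - 2 : ℝ) ≠ 0 := by linarith
  have hn1 : (n : ℝ) - 1 ≠ 0 := by linarith
  have hω := (sphereArea_pos n).ne'
  have hz1 : ∀ x v : EuclideanSpace ℝ (Fin (n + 1)), x ≠ v →
      ‖x - v‖ ^ (2 * (m : ℤ) - ((n : ℤ) + 3)) = (‖x - v‖ ^ 2) ^ b := fun x v hxv =>
    zpow_eq_sq_rpow (norm_pos_iff.2 (sub_ne_zero.2 hxv)) (by rw [hb]; push_cast; ring)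
  have hz2 : ∀ x v : EuclideanSpace ℝ (Fin (n + 1)), x ≠ v →
      ‖x - v‖ ^ (2 * ((m - 1 : ℕ) : ℤ) - ((n : ℤ) + 1)) = (‖x - v‖ ^ 2) ^ b := fun x v hxv =>
    zpow_eq_sq_rpow (norm_pos_iff.2 (sub_ne_zero.2 hxv)) (by
      rw [hb]; push_cast [Nat.cast_sub (by omega : 1 ≤ m)]; ring)
  by_cases hcase : Even n ∨ 2 * m ≤ n + 1
  -- The thresholds match: D_m and 𝒟_{m-1} always fall in the same branch.
  · have hcase' : Even n ∨ 2 * (m - 1) + 1 ≤ n := hcase.imp_right (by omega)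
    have hprod : (∏ k ∈ Finset.Icc 1 (m - 1 - 1), gammaCoeff n k) ≠ 0 := by
      refine Finset.prod_ne_zero_iff.2 fun k hk => ?_
      rw [Finset.mem_Icc] at hk
      refine gammaCoeff_ne_zero hk.1 ?_
      rcases hcase with ⟨j, hj⟩ | h <;> omega
    -- Taking the divergence multiplies ρ = s^b by n + 1 + 2b = 2m - 2, which d divides out. Only d
    -- must be nonzero, so the β-product needs no check.
    refine ⟨(-(1 / sphereArea n)) / (∏ k ∈ Finset.Icc 1 (m - 1), betaCoeff n k),
      (1 / (((n : ℝ) - 1) * sphereArea n)) / (∏ k ∈ Finset.Icc 1 (m - 1 - 1), gammaCoeff n k) / (2 * m - 2), 0, 1, ?_,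
      fun x v hxv => ⟨?_, ?_⟩⟩
    · exact div_ne_zero (div_ne_zero (one_div_ne_zero (mul_ne_zero hn1 hω)) hprod) hN0
    · rw [poissonField, if_pos hcase, hz1 x v hxv, radialProfile, zero_mul, zero_add, mul_one]
    · rw [polyharmonicKernel, if_pos hcase', hz2 x v hxv, radialProfile, hN]
      generalize (2 * (m : ℝ) - 2) = N at hN0 ⊢
      field_simp
      ring
  · have hcase' : ¬ (Even n ∨ 2 * (m - 1) + 1 ≤ n) := by
      rw [not_or] at hcase ⊢
      exact ⟨hcase.1, by omega⟩
    have hodd : n % 2 = 1 := Nat.odd_iff.1 (Nat.not_even_iff_odd.1 (not_or.1 hcase).1)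
    have hmn := (not_or.1 hcase).2
    have hT : m - 1 - (n + 1) / 2 = m - (n + 3) / 2 := by omega
    have hTN : 2 * ((m - (n + 3) / 2 : ℕ) : ℝ) + n + 1 = 2 * m - 2 := by
      have : 2 * (m - (n + 3) / 2) + n + 1 + 2 = 2 * m := by omega
      have : ((2 * (m - (n + 3) / 2) + n + 1 + 2 : ℕ) : ℝ) = ((2 * m : ℕ) : ℝ) := by rw [this]
      push_cast at this
      linarith
    have hprod : (∏ k ∈ Finset.Icc 1 ((n - 1) / 2 - 1), gammaCoeff n k) ≠ 0 := by
      refine Finset.prod_ne_zero_iff.2 fun k hk => ?_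
      rw [Finset.mem_Icc] at hk
      exact gammaCoeff_ne_zero hk.1 (by omega)
    have hprod2 : (∏ t ∈ Finset.Icc 1 (m - (n + 3) / 2), deltaCoeff n (2 * (t : ℝ))) ≠ 0 :=
      Finset.prod_ne_zero_iff.2 fun t ht =>
        deltaCoeff_two_mul_ne_zero hn (Finset.mem_Icc.1 ht).1
    set S := ∑ t ∈ Finset.Icc 1 (m - (n + 3) / 2),
      (1 / (2 * (t : ℝ)) + 1 / (2 * (t : ℝ) + n + 1)) with hS
    have hlog : ∀ x v : EuclideanSpace ℝ (Fin (n + 1)),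
        Real.log (‖x - v‖ ^ 2) = 2 * Real.log ‖x - v‖ := fun x v => by
      rw [Real.log_pow]; norm_num
    -- Here l = 1/2 because log |x - v|² = 2 log |x - v|, and κ = -S is the bracket's constant in
    -- D_m.
    refine ⟨(-(1 / sphereArea n)) / (((n : ℝ) + 1)
        * (∏ k ∈ Finset.Icc 1 ((n + 1) / 2 - 1), betaCoeff n k)
        * (∏ t ∈ Finset.Icc 1 (m - (n + 3) / 2), alphaCoeff n (2 * (t : ℝ)))),
      (1 / (((n : ℝ) - 1) * sphereArea n)) / (((n : ℝ) - 1)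
        * (∏ k ∈ Finset.Icc 1 ((n - 1) / 2 - 1), gammaCoeff n k)
        * (∏ t ∈ Finset.Icc 1 (m - (n + 3) / 2), deltaCoeff n (2 * (t : ℝ)))) / (2 * m - 2),
      1 / 2, -S, ?_, fun x v hxv => ⟨?_, ?_⟩⟩
    · exact div_ne_zero (div_ne_zero (one_div_ne_zero (mul_ne_zero hn1 hω))
        (mul_ne_zero (mul_ne_zero hn1 hprod) hprod2)) hN0
    · rw [poissonField, if_neg hcase, hz1 x v hxv, radialProfile, hlog, ← hS, mul_assoc]
      congr 3
      ring
    · rw [polyharmonicKernel, if_neg hcase', hz2 x v hxv, radialProfile, hlog, hN, hT,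
        sum_one_div_telescope, ← hS, hTN]
      generalize (2 * (m : ℝ) - 2) = N at hN0 ⊢
      field_simp
      ring

/-- The surface kernel of a weakly singular radial field. -/
noncomputable def surfaceKernel {n : ℕ} (D : Set (EuclideanSpace ℝ (Fin (n + 1)))) (b l κ : ℝ)
    (P Q : EuclideanSpace ℝ (Fin (n + 1))) : ℝ :=
  radialProfile b l κ (‖P - Q‖ ^ 2) * inner ℝ (outerNormal D P) (P - Q)

namespace IsBoundedLipschitzDomain

variable {n : ℕ} {D : Set (EuclideanSpace ℝ (Fin (n + 1)))}

theorem aestronglyMeasurable_surfaceKernel (hD : IsBoundedLipschitzDomain n D) (b l κ : ℝ) :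
    AEStronglyMeasurable (Function.uncurry (surfaceKernel D b l κ))
      ((surfaceMeasure n D).prod (surfaceMeasure n D)) := by
  have := hD.isFiniteMeasure_surfaceMeasure
  have h1 : Measurable fun z : EuclideanSpace ℝ (Fin (n + 1)) × EuclideanSpace ℝ (Fin (n + 1)) =>
      radialProfile b l κ (‖z.1 - z.2‖ ^ 2) :=
    (measurable_radialProfile b l κ).comp (by fun_prop)
  refine h1.aestronglyMeasurable.mul (hD.aestronglyMeasurable_outerNormal.comp_fst.inner ?_)
  exact (by fun_prop : Continuous fun z : EuclideanSpace ℝ (Fin (n + 1)) ×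
    EuclideanSpace ℝ (Fin (n + 1)) => z.1 - z.2).aestronglyMeasurable

/-- The majorant A |P - Q|^{-(n-1)} is symmetric, so one Riesz potential bound controls rows and
columns alike. -/
theorem exists_surfaceKernel_bound (hD : IsBoundedLipschitzDomain n D) (hn : 1 ≤ n) {b : ℝ}
    (hb : -(n : ℝ) / 2 < b) (l κ : ℝ) :
    ∃ M : ℝ≥0,
      (∀ᵐ P ∂surfaceMeasure n D, ∫⁻ Q, ‖surfaceKernel D b l κ P Q‖ₑ ∂surfaceMeasure n D ≤ M) ∧
      (∀ᵐ Q ∂surfaceMeasure n D, ∫⁻ P, ‖surfaceKernel D b l κ P Q‖ₑ ∂surfaceMeasure n D ≤ M) := by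
  obtain ⟨R, hR0, hR⟩ := hD.exists_subset_closedBall 0
  obtain ⟨A, hA0, hA⟩ := exists_abs_radialProfile_norm_sq_le hb l κ (2 * R)
  obtain ⟨M, hM⟩ := hD.exists_lintegral_surfaceMeasure_le hn (by positivity : 0 ≤ 2 * R)
  have hmem : ∀ᵐ P ∂surfaceMeasure n D, P ∈ frontier D :=
    ae_restrict_mem isClosed_frontier.measurableSet
  have hdist : ∀ P ∈ frontier D, ∀ Q ∈ frontier D, dist P Q ≤ 2 * R := fun P hP Q hQ => by
    have h1 := Metric.mem_closedBall.1 (hR (frontier_subset_closure hP))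
    have h2 := Metric.mem_closedBall.1 (hR (frontier_subset_closure hQ))
    linarith [dist_triangle_right P Q 0]
  have hpt : ∀ P ∈ frontier D, ∀ Q ∈ frontier D, ‖surfaceKernel D b l κ P Q‖ₑ
      ≤ ENNReal.ofReal A * ENNReal.ofReal ((dist P Q ^ (n - 1))⁻¹) := fun P hP Q hQ => by
    rw [← ENNReal.ofReal_mul hA0, ← ofReal_norm]
    refine ENNReal.ofReal_le_ofReal ?_
    rw [surfaceKernel]
    rcases eq_or_ne P Q with rfl | hPQ
    · simp only [sub_self, inner_zero_right, mul_zero, norm_zero]; positivity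
    have hr : 0 < ‖P - Q‖ := norm_pos_iff.2 (sub_ne_zero.2 hPQ)
    have hb1 := hA ‖P - Q‖ 0 hr (by rw [← dist_eq_norm]; exact hdist P hP Q hQ) le_rfl zero_le_one
    rw [zero_pow two_ne_zero, add_zero] at hb1
    rw [dist_eq_norm, ← inv_pow_mul_self hn hr, ← mul_assoc, norm_mul]
    refine mul_le_mul hb1 ?_ (norm_nonneg _) (by positivity)
    exact (norm_inner_le_norm _ _).trans
      (mul_le_of_le_one_left (norm_nonneg _) (norm_outerNormal_le D P))
  have hint : ∀ P ∈ frontier D, ∫⁻ Q, ENNReal.ofReal A * ENNReal.ofReal ((dist Q P ^ (n - 1))⁻¹)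
      ∂surfaceMeasure n D ≤ (A.toNNReal * M : ℝ≥0) := fun P hP => by
    rw [lintegral_const_mul _ (by fun_prop), ENNReal.coe_mul]
    refine mul_le_mul' le_rfl (le_trans (le_of_eq ?_) (hM P))
    rw [Measure.restrict_eq_self_of_ae_mem]
    filter_upwards [hmem] with Q hQ using Metric.mem_closedBall.2 (hdist Q hQ P hP)
  refine ⟨A.toNNReal * M, ?_, ?_⟩
  · filter_upwards [hmem] with P hP
    refine (lintegral_mono_ae ?_).trans (hint P hP)
    filter_upwards [hmem] with Q hQ
    rw [dist_comm]
    exact hpt P hP Q hQ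
  · filter_upwards [hmem] with Q hQ
    refine (lintegral_mono_ae ?_).trans (hint Q hQ)
    filter_upwards [hmem] with P hP using hpt P hP Q hQ

theorem integrableOn_radialProfile (hD : IsBoundedLipschitzDomain n D) {b : ℝ}
    (hb : -(n : ℝ) / 2 < b) (l κ : ℝ) (Y : EuclideanSpace ℝ (Fin (n + 1))) :
    IntegrableOn (fun X => radialProfile b l κ (‖X - Y‖ ^ 2)) D := by
  obtain ⟨R, hR0, hR⟩ := hD.exists_subset_closedBall Y
  obtain ⟨A, hA0, hA⟩ := exists_abs_radialProfile_norm_sq_le hb l κ R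
  refine Integrable.mono' ((hD.integrableOn_inv_dist_pow Y).const_mul A)
    ((measurable_radialProfile b l κ).comp (by fun_prop)).aestronglyMeasurable ?_
  have hY : ∀ᵐ X ∂(volume.restrict D), X ≠ Y :=
    ae_restrict_of_ae (measure_eq_zero_iff_ae_notMem.1 (measure_singleton Y))
  filter_upwards [hY, ae_restrict_mem hD.isOpen.measurableSet] with X hX hXD
  have hr : 0 < ‖X - Y‖ := norm_pos_iff.2 (sub_ne_zero.2 hX)
  have := hA ‖X - Y‖ 0 hr (by
    rw [← dist_eq_norm]; exact Metric.mem_closedBall.1 (hR (subset_closure hXD))) le_rfl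
    zero_le_one
  rwa [zero_pow two_ne_zero, add_zero, ← dist_eq_norm X Y] at this

end IsBoundedLipschitzDomain

end Kernels

theorem theorem8p10 (n m : ℕ) (hn : 2 ≤ n) (hm : 2 ≤ m)
    (D : Set (EuclideanSpace ℝ (Fin (n + 1)))) (hD : IsBoundedLipschitzDomain n D) :
    (∃ C : ℝ≥0, ∀ p : ℝ≥0∞, 1 ≤ p →
      ∀ f : EuclideanSpace ℝ (Fin (n + 1)) → ℝ, MemLp f p (surfaceMeasure n D) →
        (∀ᵐ P ∂(surfaceMeasure n D),
          Integrable (fun Q => adjointKernel m D P Q * f Q) (surfaceMeasure n D)) ∧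
        MemLp (adjointOperator m D f) p (surfaceMeasure n D) ∧
        eLpNorm (adjointOperator m D f) p (surfaceMeasure n D)
          ≤ C * eLpNorm f p (surfaceMeasure n D)) ∧
    (∀ Y : EuclideanSpace ℝ (Fin (n + 1)),
      IntegrableOn (fun X => polyharmonicKernel n (m - 1) X Y) D) ∧
    (∀ p : ℝ≥0∞, 1 ≤ p →
      ∀ f : EuclideanSpace ℝ (Fin (n + 1)) → ℝ, MemLp f p (surfaceMeasure n D) →
        Integrable (fun Q => newtonianPotential (m - 1) D Q * f Q) (surfaceMeasure n D) ∧
        Integrable (adjointOperator m D f) (surfaceMeasure n D) ∧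
        (∫ Q, newtonianPotential (m - 1) D Q * f Q ∂(surfaceMeasure n D) = 0 →
          ∫ P, adjointOperator m D f P ∂(surfaceMeasure n D) = 0)) := by
  have hfin := hD.isFiniteMeasure_surfaceMeasure
  set σ := surfaceMeasure n D with hσ
  have hn1 : 1 ≤ n := by omega
  have hm2 : (2 : ℝ) ≤ m := by exact_mod_cast hm
  set b : ℝ := (2 * m - n - 3) / 2 with hbdef
  -- This is where m ≥ 2 enters: 2b = 2m - n - 3 ≥ 1 - n.
  have hb : -(n : ℝ) / 2 < b := by rw [hbdef]; linarith
  obtain ⟨e, d, l, κ, hd, hker⟩ := exists_radialProfile_kernels hn hm (b := b)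
    (by rw [hbdef]; ring)
  -- The sign appears because D_m is taken at (Q, P) and is odd in Q - P. On the diagonal both sides
  -- are 0.
  have hadj : ∀ P Q, adjointKernel m D P Q = -e * surfaceKernel D b l κ P Q := fun P Q => by
    rw [adjointKernel, surfaceKernel]
    rcases eq_or_ne Q P with rfl | hQP
    · simp [poissonField_self]
    · rw [(hker Q P hQP).1, real_inner_smul_left, real_inner_comm, norm_sub_rev,
        ← neg_sub P Q, inner_neg_right]
      ring
  have hT : ∀ f, adjointOperator m D f
      = fun P => -e * ∫ Q, surfaceKernel D b l κ P Q * f Q ∂σ := fun f => by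
    funext P
    rw [adjointOperator, ← integral_const_mul]
    simp only [hadj, mul_assoc, hσ]
  have hmk := hD.aestronglyMeasurable_surfaceKernel b l κ
  obtain ⟨M, hrow, hcol⟩ := hD.exists_surfaceKernel_bound hn1 hb l κ
  have hpoly : ∀ Y, (fun X => polyharmonicKernel n (m - 1) X Y) =ᵐ[volume.restrict D]
      fun X => d * radialProfile b ((n + 1 + 2 * b) * l) ((n + 1 + 2 * b) * κ + 2 * l)
        (‖X - Y‖ ^ 2) := fun Y => by
    have hY : ∀ᵐ X ∂(volume.restrict D), X ≠ Y :=
      ae_restrict_of_ae (measure_eq_zero_iff_ae_notMem.1 (measure_singleton Y))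
    filter_upwards [hY] with X hX using (hker X Y hX).2
  -- The Newtonian potential is d times the column integral of the kernel whose row integrals define
  -- K*_m.
  have hnewt : ∀ Q, newtonianPotential (m - 1) D Q
      = d * ∫ P, surfaceKernel D b l κ P Q ∂σ := fun Q => by
    rw [newtonianPotential, integral_congr_ae (hpoly Q), integral_const_mul,
      hD.setIntegral_radialProfile hn1 hb l κ Q]
    rfl
  have hprod : ∀ f, Integrable f σ → Integrable
      (Function.uncurry fun P Q => surfaceKernel D b l κ P Q * f Q) (σ.prod σ) :=
    fun f hf => integrable_kernel_mul hmk hcol hf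
  have hmain : ∀ p : ℝ≥0∞, 1 ≤ p → ∀ f : EuclideanSpace ℝ (Fin (n + 1)) → ℝ, MemLp f p σ →
      MemLp (adjointOperator m D f) p σ ∧
        eLpNorm (adjointOperator m D f) p σ ≤ (‖e‖₊ * M : ℝ≥0) * eLpNorm f p σ := by
    intro p hp f hf
    have hle : eLpNorm (adjointOperator m D f) p σ ≤ (‖e‖₊ * M : ℝ≥0) * eLpNorm f p σ := by
      rw [hT, ENNReal.coe_mul, mul_assoc]
      refine (eLpNorm_const_smul_le (c := -e)
        (f := fun P => ∫ Q, surfaceKernel D b l κ P Q * f Q ∂σ)).trans ?_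
      rw [enorm_neg]
      exact mul_le_mul' le_rfl (eLpNorm_kernel_le hmk hrow hcol hp hf.1)
    refine ⟨⟨?_, hle.trans_lt (ENNReal.mul_lt_top ENNReal.coe_lt_top hf.2)⟩, hle⟩
    rw [hT]
    exact ((hprod f (hf.integrable hp)).1.integral_prod_right').const_mul _
  refine ⟨⟨‖e‖₊ * M, fun p hp f hf => ⟨?_, hmain p hp f hf⟩⟩, fun Y => ?_, fun p hp f hf => ?_⟩
  · filter_upwards [(hprod f (hf.integrable hp)).prod_right_ae] with P hP
    simp only [hadj, mul_assoc]
    exact hP.const_mul _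
  · exact ((hD.integrableOn_radialProfile hb _ _ Y).const_mul d).congr (hpoly Y).symm
  · have hf1 := hf.integrable hp
    have hsw := integral_integral_swap (hprod f hf1)
    have hI : ∀ Q, ∫ P, surfaceKernel D b l κ P Q * f Q ∂σ
        = (∫ P, surfaceKernel D b l κ P Q ∂σ) * f Q := fun Q => integral_mul_const _ _
    refine ⟨?_, (hmain p hp f hf).1.integrable hp, fun h0 => ?_⟩
    -- Integrating the product kernel in P leaves the column integral times f(Q), so Fubini also
    -- gives integrability of the potential times f.
    · have := (hprod f hf1).integral_prod_right
      simp only [Function.uncurry, hI] at this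
      simp only [hnewt, mul_assoc]
      exact this.const_mul d
    · simp only [hnewt, mul_assoc] at h0
      rw [integral_const_mul] at h0
      have h0' := (mul_eq_zero.1 h0).resolve_left hd
      rw [hT, integral_const_mul, hsw]
      simp only [hI]
      rw [h0', mul_zero]
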